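/- Let $d\ge 2$ and $n\ge 1$ be integers, and for $c\in\mathbb C$ put $f_c(z)=z^d+c$. A point $z\in\mathbb C$ has period $k\ge 1$ for $f_c$ if $f_c^{\circ k}(z)=z$ and $f_c^{\circ j}(z)\ne z$ for all $0<j<k$; its multiplier is then $(f_c^{\circ k})'(z)$. Let $$X_n=\{(c,z)\in\mathbb C^2 : z \text{ has period } n \text{ for } f_c \text{ and multiplier different from } 1\},$$ let $\overline{X_n}$ be its closure in $\mathbb C^2$, and let $\partial X_n=\overline{X_n}\setminus X_n$. Then $\overline{X_n}$ is a smooth complex curve in $\mathbb C^2$, that is, near each of its points it is the zero set of a holomorphic function whose differential at that point is nonzero. More precisely: 1. $\partial X_n$ is finite, and it is the set of all $(c,z)\in\mathbb C^2$ such that, for some $m\le n$ dividing $n$, $z$ has period $m$ for $f_c$ and its multiplier is of the form $e^{2\pi i u/v}$ with $u,v\ge 1$ coprime integers and $v=n/m$. 2. If $(c_0,z_0)\in X_n$, then in a neighborhood of $(c_0,z_0)$ the set $\overline{X_n}$ is the graph of a holomorphic map $c\mapsto z(c)$, defined near $c_0$, with $z(c_0)=z_0$. 3. If $(c_0,z_0)\in\partial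 X_n$, then in a neighborhood of $(c_0,z_0)$ the set $\overline{X_n}$ is the graph of a holomorphic map $z\mapsto c(z)$, defined near $z_0$, with $c(z_0)=c_0$ and $c'(z_0)=0$. -/

import Mathlib

open Filter Topology

/-- The unicritical polynomial `f_c(z) = z ^ d + c`. -/
def unicritical (d : ℕ) (c z : ℂ) : ℂ := z ^ d + c

/-- `z` is periodic of (exact) period `n ≥ 1` for `f`. -/
def HasPeriod (f : ℂ → ℂ) (n : ℕ) (z : ℂ) : Prop :=
  0 < n ∧ f^[n] z = z ∧ ∀ m : ℕ, 0 < m → m < n → f^[m] z ≠ z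

/-- The derivative of the `n`-th iterate of `f` at `z`; it is the multiplier of `z` when `z` has
period `n` for `f`. -/
noncomputable def multiplier (f : ℂ → ℂ) (n : ℕ) (z : ℂ) : ℂ := deriv (f^[n]) z

/-- The set `X_n` of pairs `(c, z)` such that `z` has period `n` for `f_c`, with multiplier
different from `1`. -/
def dynatomicX (d n : ℕ) : Set (ℂ × ℂ) :=
  {p | HasPeriod (unicritical d p.1) n p.2 ∧ multiplier (unicritical d p.1) n p.2 ≠ 1}

/-- The boundary of a curve `X` in `ℂ²`: the points of the closure that are not in `X`. (A curve has
empty interior in `ℂ²`, so this is not the topological frontier.) -/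
def curveBoundary (X : Set (ℂ × ℂ)) : Set (ℂ × ℂ) := closure X \ X

/-- `S` is a smooth complex curve in `ℂ²`: near each of its points it is the zero set
of a holomorphic function with nonvanishing differential at that point. -/
def IsSmoothComplexCurve (S : Set (ℂ × ℂ)) : Prop :=
  ∀ p ∈ S, ∃ F : ℂ × ℂ → ℂ, AnalyticAt ℂ F p ∧ fderiv ℂ F p ≠ 0 ∧
    ∀ᶠ q in 𝓝 p, (q ∈ S ↔ F q = 0)

/-! Locally the curve is the zero set of one analytic function $P(c,z)$. At a point of $X_n$,
$P=f_c^{\circ n}(z)-z$ has $\partial P/\partial z\ne0$, which gives a graph over $c$. At a boundary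
point of period $m$, with $n=mv$, $P$ is $f_c^{\circ m}(z)-z$ if $v=1$ and its quotient into
$f_c^{\circ mv}(z)-z$ (`orbitQuot`) if $v\ge2$. Then $\partial P/\partial z=0$, and everything rests
on $\partial P/\partial c\ne0$, which gives a graph over $z$ with vertical tangent
(`exists_graph_of_vertical_tangent`).

For $v=1$ this is `deriv_orbit_param_ne_zero`. For $v\ge2$, $P$ restricted to the curve of
$m$-periodic points is $1+L+\dots+L^{v-1}$, where $L$ is the multiplier, so it suffices that
$L'\ne0$ (`deriv_multiplier_ne_zero`). If either derivative vanished, there would be a nonzero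
quadratic differential $q=\sum_k\bigl(A/(x-z_k)^2+\rho_k/(x-z_k)\bigr)dx^2$ with poles on the cycle,
$A=0$ or $1$, and $f_*q=q$: the vanishing derivative says $\sum\rho_k=0$, which removes the pole of
$f_*q$ at the critical value.

No such $q$ exists (`pole_coeff_eq_zero_of_cycle`). Push-forward does not increase mass, while
$f^{-1}(V)$ is much smaller than $V$ for a large disc $V$, so $q$ vanishes on an open set. Since
double poles have infinite mass, discs of radius $|(f^{\circ k})'|\varepsilon$ are removed around
the cycle. The radii match up because the multiplier has modulus one, and the mass that leaks is
$O(\varepsilon)$.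

Conversely, the quotients vanish on $X_n$, hence on its closure, and this forces the multiplier at a
boundary point to be a primitive $v$-th root of unity. The boundary is bounded and the local graphs
show that it does not accumulate, so it is finite. -/

/-! ### Sums over the fibres of the power map. -/

theorem sum_rootOfUnity_mul_pow {d : ℕ} {ω : ℂ} (hω : IsPrimitiveRoot ω d) (g : ℂ) {e : ℕ}
    (he : ¬ d ∣ e) : ∑ j ∈ Finset.range d, (ω ^ j * g) ^ e = 0 := by
  have h1 : ω ^ e ≠ 1 := fun h => he (hω.dvd_of_pow_eq_one e h)
  have h2 : ∑ j ∈ Finset.range d, (ω ^ e) ^ j = 0 := by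
    have := mul_geom_sum (ω ^ e) d
    rw [← pow_mul, mul_comm e d, pow_mul, hω.pow_eq_one, one_pow, sub_self] at this
    exact (mul_eq_zero.1 this).resolve_left (sub_ne_zero.2 h1)
  calc ∑ j ∈ Finset.range d, (ω ^ j * g) ^ e = (∑ j ∈ Finset.range d, (ω ^ e) ^ j) * g ^ e := by
        rw [Finset.sum_mul]
        refine Finset.sum_congr rfl fun j _ => ?_
        rw [mul_pow, ← pow_mul, ← pow_mul, mul_comm e j]
    _ = 0 := by rw [h2, zero_mul]

/-- Sum of `x² / (x - a)` over the `d`-th roots `x` of `t`. -/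
theorem sum_roots_sq_div_sub {d : ℕ} (hd : 2 ≤ d) {ω g t a : ℂ} (hω : IsPrimitiveRoot ω d)
    (hg : g ^ d = t) (hta : t ≠ a ^ d) :
    ∑ j ∈ Finset.range d, (ω ^ j * g) ^ 2 / (ω ^ j * g - a) = d * a * t / (t - a ^ d) := by
  have hx : ∀ j, (ω ^ j * g) ^ d = t := fun j => by
    rw [mul_pow, ← pow_mul, mul_comm j d, pow_mul, hω.pow_eq_one, one_pow, one_mul, hg]
  have hs : t - a ^ d ≠ 0 := sub_ne_zero.2 hta
  have h1 : ∀ j, (ω ^ j * g) ^ 2 / (ω ^ j * g - a) =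
      (∑ i ∈ Finset.range d, (ω ^ j * g) ^ (i + 2) * a ^ (d - 1 - i)) / (t - a ^ d) := by
    intro j
    have h2 := geom_sum₂_mul (ω ^ j * g) a d
    rw [hx j] at h2
    have h3 : ω ^ j * g - a ≠ 0 := by
      intro h
      rw [h, mul_zero] at h2
      exact hs h2.symm
    rw [div_eq_div_iff h3 hs, ← h2]
    simp only [pow_add, Finset.sum_mul, Finset.mul_sum]
    exact Finset.sum_congr rfl fun i _ => by ring
  simp_rw [h1]
  rw [← Finset.sum_div, Finset.sum_comm]
  congr 1
  simp_rw [← Finset.sum_mul]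
  -- The exponents `i + 2` run from `2` to `d + 1`, where `d` is the only multiple of `d`.
  rw [Finset.sum_eq_single (d - 2)]
  · have e1 : d - 2 + 2 = d := by omega
    have e2 : d - 1 - (d - 2) = 1 := by omega
    simp_rw [e1, e2, hx]
    simp
    ring
  · intro i hi hne
    rw [sum_rootOfUnity_mul_pow hω, zero_mul]
    rintro ⟨k, hk⟩
    have hi' := Finset.mem_range.1 hi
    have : k = 1 := by
      rcases k with _ | _ | k
      · omega
      · rfl
      · have : d * 2 ≤ d * (k + 1 + 1) := Nat.mul_le_mul_left d (by omega)
        omega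
    subst this
    omega
  · intro h
    exact absurd (Finset.mem_range.2 (by omega)) h

/-- Sum of `x² / (x - a)²` over the `d`-th roots `x` of `t`. -/
theorem sum_roots_sq_div_sub_sq {d : ℕ} (hd : 2 ≤ d) {ω g t a : ℂ} (hω : IsPrimitiveRoot ω d)
    (hg : g ^ d = t) (hta : t ≠ a ^ d) :
    ∑ j ∈ Finset.range d, (ω ^ j * g) ^ 2 / (ω ^ j * g - a) ^ 2 =
      d * t / (t - a ^ d) + d ^ 2 * a ^ d * t / (t - a ^ d) ^ 2 := by
  have hx : ∀ j, (ω ^ j * g) ^ d = t := fun j => by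
    rw [mul_pow, ← pow_mul, mul_comm j d, pow_mul, hω.pow_eq_one, one_pow, one_mul, hg]
  have hs : t - a ^ d ≠ 0 := sub_ne_zero.2 hta
  have hxa : ∀ j, ω ^ j * g - a ≠ 0 := fun j h => hta (by rw [← hx j, sub_eq_zero.1 h])
  -- The identity is the derivative of `sum_roots_sq_div_sub` with respect to the pole `a`.
  have hL : HasDerivAt (fun b : ℂ => ∑ j ∈ Finset.range d, (ω ^ j * g) ^ 2 / (ω ^ j * g - b))
      (∑ j ∈ Finset.range d, (ω ^ j * g) ^ 2 / (ω ^ j * g - a) ^ 2) a := by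
    refine HasDerivAt.fun_sum fun j _ => ?_
    have := (hasDerivAt_const a ((ω ^ j * g) ^ 2)).fun_div
      ((hasDerivAt_id a).const_sub (ω ^ j * g)) (hxa j)
    refine this.congr_deriv ?_
    simp
  have hR : HasDerivAt (fun b : ℂ => d * b * t / (t - b ^ d))
      (d * t / (t - a ^ d) + d ^ 2 * a ^ d * t / (t - a ^ d) ^ 2) a := by
    have h1 : HasDerivAt (fun b : ℂ => d * b * t) (d * t) a := by
      simpa using ((hasDerivAt_id a).const_mul (d : ℂ)).mul_const t
    have h2 : HasDerivAt (fun b : ℂ => t - b ^ d) (-(d * a ^ (d - 1))) a :=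
      (hasDerivAt_pow d a).const_sub t
    refine (h1.fun_div h2 hs).congr_deriv ?_
    have : a ^ d = a ^ (d - 1) * a := by rw [← pow_succ]; congr 1; omega
    field_simp
    rw [this]
    ring
  have hev : (fun b : ℂ => ∑ j ∈ Finset.range d, (ω ^ j * g) ^ 2 / (ω ^ j * g - b)) =ᶠ[𝓝 a]
      fun b : ℂ => d * b * t / (t - b ^ d) := by
    have : ∀ᶠ b in 𝓝 a, t - b ^ d ≠ 0 :=
      (show Continuous fun b : ℂ => t - b ^ d by fun_prop).continuousAt.eventually_ne hs
    filter_upwards [this] with b hb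
    exact sum_roots_sq_div_sub hd hω hg (sub_ne_zero.1 hb)
  exact hL.unique (hR.congr_of_eventuallyEq hev)

/-! ### Quadratic differentials with poles on a cycle, and their push-forward. -/

/-- The coefficient of the quadratic differential with double poles of coefficient `A` and
residues `ρ k` at the points `z k`, `k < m`. -/
noncomputable def poleSum (m : ℕ) (z ρ : ℕ → ℂ) (A x : ℂ) : ℂ :=
  ∑ k ∈ Finset.range m, (A / (x - z k) ^ 2 + ρ k / (x - z k))

theorem sum_range_shift {M : Type*} [AddCommGroup M] {m : ℕ} {g : ℕ → M} (h : g m = g 0) :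
    ∑ k ∈ Finset.range m, g (k + 1) = ∑ k ∈ Finset.range m, g k := by
  have := Finset.sum_range_succ g m
  rw [Finset.sum_range_succ', h] at this
  exact add_right_cancel this

/-- A suitable quadratic differential with poles on a cycle is fixed by the push-forward by
`x ↦ x ^ d + c`. -/
theorem poleSum_pushforward {d m : ℕ} (hd : 2 ≤ d) {c A : ℂ} {z ρ : ℕ → ℂ}
    (hz : ∀ k, z (k + 1) = z k ^ d + c) (hzm : z m = z 0) (hz0 : ∀ k < m, z k ≠ 0)
    (hρ : ∀ k, ρ (k + 1) = ρ k / (d * z k ^ (d - 1)) - A * (d - 1) / (d * z k ^ d))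
    (hρm : ρ m = ρ 0) (hsum : ∑ k ∈ Finset.range m, ρ k = 0)
    {ω g w : ℂ} (hω : IsPrimitiveRoot ω d) (hg : g ^ d = w - c) (hwc : w ≠ c)
    (hw : ∀ k < m, w ≠ z (k + 1)) :
    ∑ j ∈ Finset.range d, poleSum m z ρ A (ω ^ j * g) / (d * (ω ^ j * g) ^ (d - 1)) ^ 2 =
      poleSum m z ρ A w := by
  set t := w - c with ht
  have ht0 : t ≠ 0 := sub_ne_zero.2 hwc
  have hd0 : (d : ℂ) ≠ 0 := by exact_mod_cast (by omega : d ≠ 0)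
  have hg0 : g ≠ 0 := by rintro rfl; rw [zero_pow (by omega)] at hg; exact ht0 hg.symm
  have hω0 : ω ≠ 0 := hω.ne_zero (by omega)
  have hx : ∀ j, (ω ^ j * g) ^ d = t := fun j => by
    rw [mul_pow, ← pow_mul, mul_comm j d, pow_mul, hω.pow_eq_one, one_pow, one_mul, hg]
  -- On the fibre $x^{d-1}=t/x$, so $1/f'(x)^2=x^2/(d^2t^2)$; this is the source of the $x^2$ in the
  -- fibre sums.
  have hjac : ∀ j, ∀ y : ℂ, y / (d * (ω ^ j * g) ^ (d - 1)) ^ 2 =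
      (ω ^ j * g) ^ 2 * y / (d ^ 2 * t ^ 2) := by
    intro j y
    have hx0 : ω ^ j * g ≠ 0 := mul_ne_zero (pow_ne_zero _ hω0) hg0
    have e : t = (ω ^ j * g) ^ (d - 1) * (ω ^ j * g) := by
      rw [← pow_succ, ← hx j]; congr 1; omega
    rw [e]
    generalize ω ^ j * g = x at hx0 ⊢
    have := pow_ne_zero (d - 1) hx0
    field_simp
  -- The polar part at `z k` is carried to one at `z (k + 1)` with the same `A`, plus a simple pole
  -- at the critical value `c`. Summed over the cycle, these extra residues cancel by `hsum`.
  have key : ∀ k < m, ∑ j ∈ Finset.range d,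
      (ω ^ j * g) ^ 2 * (A / (ω ^ j * g - z k) ^ 2 + ρ k / (ω ^ j * g - z k)) / (d ^ 2 * t ^ 2) =
      A / (w - z (k + 1)) ^ 2 + ρ (k + 1) / (w - z (k + 1)) - ρ (k + 1) / t := by
    intro k hk
    have hs : t - z k ^ d ≠ 0 := by
      intro h
      apply hw k hk
      rw [hz k, ← sub_eq_zero, ← h, ht]; ring
    have e : w - z (k + 1) = t - z k ^ d := by rw [hz, ht]; ring
    rw [e, hρ]
    calc _ = (A * ∑ j ∈ Finset.range d, (ω ^ j * g) ^ 2 / (ω ^ j * g - z k) ^ 2 +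
          ρ k * ∑ j ∈ Finset.range d, (ω ^ j * g) ^ 2 / (ω ^ j * g - z k)) / (d ^ 2 * t ^ 2) := by
          rw [Finset.mul_sum, Finset.mul_sum, ← Finset.sum_add_distrib, Finset.sum_div]
          exact Finset.sum_congr rfl fun j _ => by ring
      _ = _ := by
          rw [sum_roots_sq_div_sub_sq hd hω hg (sub_ne_zero.1 hs),
            sum_roots_sq_div_sub hd hω hg (sub_ne_zero.1 hs)]
          have e2 : z k ^ d = z k ^ (d - 1) * z k := by rw [← pow_succ]; congr 1; omega
          have hz0' := hz0 k hk
          rw [e2] at hs ⊢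
          generalize z k = a at hz0' hs ⊢
          have hp := pow_ne_zero (d - 1) hz0'
          generalize a ^ (d - 1) = b at hp hs ⊢
          field_simp
          ring
  calc _ = ∑ j ∈ Finset.range d, ∑ k ∈ Finset.range m,
      (ω ^ j * g) ^ 2 * (A / (ω ^ j * g - z k) ^ 2 + ρ k / (ω ^ j * g - z k)) / (d ^ 2 * t ^ 2) := by
        refine Finset.sum_congr rfl fun j _ => ?_
        rw [hjac, poleSum, Finset.mul_sum, Finset.sum_div]
    _ = ∑ k ∈ Finset.range m,
        (A / (w - z (k + 1)) ^ 2 + ρ (k + 1) / (w - z (k + 1)) - ρ (k + 1) / t) := by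
        rw [Finset.sum_comm]
        exact Finset.sum_congr rfl fun k hk => key k (Finset.mem_range.1 hk)
    _ = _ := by
        rw [Finset.sum_sub_distrib, ← Finset.sum_div, sum_range_shift hρm, hsum, zero_div, sub_zero]
        exact sum_range_shift (g := fun k => A / (w - z k) ^ 2 + ρ k / (w - z k)) (by simp only [hzm, hρm])
-- Push-forward does not increase mass.
open MeasureTheory

/-- The principal branch of the root is used off a slit only, so the slit has to be negligible. -/
theorem volume_sub_notMem_slitPlane (c : ℂ) :
    volume {w : ℂ | w - c ∉ Complex.slitPlane} = 0 := by
  have h1 : volume ((LinearMap.ker Complex.imLm : Submodule ℝ ℂ) : Set ℂ) = 0 := by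
    refine Measure.addHaar_submodule _ _ fun h => ?_
    have : Complex.I ∈ LinearMap.ker Complex.imLm := h ▸ Submodule.mem_top
    simp at this
  have h2 := (measurePreserving_sub_right (volume : Measure ℂ) c).quasiMeasurePreserving.preimage_null h1
  refine measure_mono_null (fun w hw => ?_) h2
  simp only [Set.mem_ofPred_eq, Complex.mem_slitPlane_iff, not_or, not_not] at hw
  simpa using hw.2

theorem ofReal_abs_det_restrictScalars (a : ℂ) :
    ENNReal.ofReal |((ContinuousLinearMap.toSpanSingleton ℂ a).restrictScalars ℝ).det| =
      ‖a‖ₑ ^ 2 := by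
  have : |((ContinuousLinearMap.toSpanSingleton ℂ a).restrictScalars ℝ).det| = ‖a‖ ^ 2 := by
    simp [ContinuousLinearMap.det, LinearMap.det_restrictScalars, Algebra.norm_complex_apply,
      Complex.normSq_eq_norm_sq]
  rw [this, ENNReal.ofReal_pow (norm_nonneg _), ofReal_norm]

/-- If the quadratic differential `q` is fixed by the push-forward by `f : x ↦ x ^ d + c`, then its
mass on `W` is at most its mass on the preimage of `W`. -/
theorem lintegral_le_lintegral_preimage {d : ℕ} (hd : d ≠ 0) {c ω : ℂ} (hω : IsPrimitiveRoot ω d)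
    {q : ℂ → ℂ} (hqm : Measurable q) {W S : Set ℂ} (hW : MeasurableSet W) (hS : S.Countable)
    (hq : ∀ w ∉ S, ∀ g : ℂ, g ^ d = w - c →
      ∑ j ∈ Finset.range d, q (ω ^ j * g) / (d * (ω ^ j * g) ^ (d - 1)) ^ 2 = q w) :
    ∫⁻ w in W, ‖q w‖ₑ ≤ ∫⁻ x in (fun x => x ^ d + c) ⁻¹' W, ‖q x‖ₑ := by
  have hd0 : (d : ℂ) ≠ 0 := by exact_mod_cast hd
  -- The `d` inverse branches of `f`. Their images are disjoint and lie over `W`; the triangle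
  -- inequality and a change of variables on each of them give the bound.
  set φ : ℕ → ℂ → ℂ := fun j w => ω ^ j * (w - c) ^ ((d : ℂ)⁻¹) with hφ
  have hφd : ∀ j w, φ j w ^ d = w - c := fun j w => by
    rw [hφ]
    simp only
    rw [mul_pow, ← pow_mul, mul_comm j d, pow_mul, hω.pow_eq_one, one_pow, one_mul,
      Complex.cpow_nat_inv_pow _ hd]
  set W' : Set ℂ := (W ∩ {w | w - c ∈ Complex.slitPlane}) \ S with hW'
  have hslit : MeasurableSet {w : ℂ | w - c ∈ Complex.slitPlane} :=
    (Complex.isOpen_slitPlane.preimage (continuous_id.sub continuous_const)).measurableSet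
  have hW'm : MeasurableSet W' := (hW.inter hslit).diff hS.measurableSet
  have hae : ∫⁻ w in W, ‖q w‖ₑ = ∫⁻ w in W', ‖q w‖ₑ := by
    refine setLIntegral_congr ?_
    have h1 : ∀ᵐ w : ℂ, w - c ∈ Complex.slitPlane := by
      rw [ae_iff]; exact volume_sub_notMem_slitPlane c
    have h2 : ∀ᵐ w : ℂ, w ∉ S := by
      rw [ae_iff]; simpa using hS.measure_zero volume
    filter_upwards [h1, h2] with w hw1 hw2
    exact propext ⟨fun h => ⟨⟨h, hw1⟩, hw2⟩, fun h => h.1.1⟩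
  have hφ0 : ∀ j, ∀ w ∈ W', φ j w ≠ 0 := by
    intro j w hw h
    have := hφd j w
    rw [h, zero_pow hd] at this
    exact Complex.slitPlane_ne_zero hw.1.2 this.symm
  have hder : ∀ j, ∀ w ∈ W', HasDerivAt (φ j) (1 / (d * φ j w ^ (d - 1))) w := by
    intro j w hw
    have h1 : HasDerivAt (φ j) _ w :=
      (((hasDerivAt_id w).sub_const c).cpow_const (c := (d : ℂ)⁻¹) hw.1.2).const_mul (ω ^ j)
    have h2 := h1.pow d
    have h3 : HasDerivAt (fun w => φ j w ^ d) 1 w := by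
      simp_rw [hφd j]
      exact (hasDerivAt_id w).sub_const c
    have h4 := h2.unique h3
    refine h1.congr_deriv ?_
    have := mul_ne_zero hd0 (pow_ne_zero (d - 1) (hφ0 j w hw))
    rw [eq_div_iff this, mul_comm]
    exact h4
  have hfder : ∀ j, ∀ w ∈ W', HasFDerivWithinAt (φ j)
      ((ContinuousLinearMap.toSpanSingleton ℂ (1 / (d * φ j w ^ (d - 1)))).restrictScalars ℝ) W' w :=
    fun j w hw => ((hder j w hw).hasFDerivAt.restrictScalars ℝ).hasFDerivWithinAt
  have hinj : ∀ j, Set.InjOn (φ j) W' := by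
    intro j w _ w' _ h
    have := hφd j w
    rw [h, hφd j w'] at this
    exact (sub_left_injective this).symm
  have himg : ∀ j, MeasurableSet (φ j '' W') := fun j =>
    measurable_image_of_fderivWithin hW'm (hfder j) (hinj j)
  have hdisj : ((Finset.range d : Finset ℕ) : Set ℕ).PairwiseDisjoint fun j => φ j '' W' := by
    intro i hi j hj hij
    refine Set.disjoint_left.2 ?_
    rintro _ ⟨w, hw, rfl⟩ ⟨w', hw', h⟩
    have h1 : w' = w := by
      have := hφd j w'
      rw [h, hφd i w] at this
      exact (sub_left_injective this).symm
    subst h1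
    have h2 : (w' - c) ^ ((d : ℂ)⁻¹) ≠ 0 := right_ne_zero_of_mul (hφ0 j w' hw')
    have h3 : ω ^ j = ω ^ i := mul_right_cancel₀ h2 h
    exact hij (hω.pow_inj (by simpa using hi) (by simpa using hj) h3.symm)
  calc ∫⁻ w in W, ‖q w‖ₑ = ∫⁻ w in W', ‖q w‖ₑ := hae
    _ ≤ ∫⁻ w in W', ∑ j ∈ Finset.range d, ‖1 / (d * φ j w ^ (d - 1))‖ₑ ^ 2 * ‖q (φ j w)‖ₑ := by
        refine setLIntegral_mono' hW'm fun w hw => ?_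
        rw [← hq w hw.2 ((w - c) ^ ((d : ℂ)⁻¹)) (Complex.cpow_nat_inv_pow _ hd)]
        refine (enorm_sum_le _ _).trans (Finset.sum_le_sum fun j _ => le_of_eq ?_)
        rw [← enorm_pow, ← enorm_mul]
        congr 1
        simp only [hφ]
        ring
    _ = ∑ j ∈ Finset.range d, ∫⁻ w in W', ‖1 / (d * φ j w ^ (d - 1))‖ₑ ^ 2 * ‖q (φ j w)‖ₑ := by
        refine lintegral_finsetSum _ fun j _ => ?_
        have h1 : Measurable (φ j) := by fun_prop
        exact ((by fun_prop : Measurable fun w => 1 / (d * φ j w ^ (d - 1))).enorm.pow_const 2).mul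
          (hqm.comp h1).enorm
    _ = ∑ j ∈ Finset.range d, ∫⁻ x in φ j '' W', ‖q x‖ₑ := by
        refine Finset.sum_congr rfl fun j _ => ?_
        rw [lintegral_image_eq_lintegral_abs_det_fderiv_mul volume hW'm (hfder j) (hinj j)]
        simp_rw [ofReal_abs_det_restrictScalars]
    _ = ∫⁻ x in ⋃ j ∈ Finset.range d, φ j '' W', ‖q x‖ₑ :=
        (lintegral_biUnion_finset hdisj (fun j _ => himg j) _).symm
    _ ≤ _ := by
        refine lintegral_mono_set ?_
        refine Set.iUnion₂_subset fun j _ => ?_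
        rintro _ ⟨w, hw, rfl⟩
        simpa [hφd j w] using hw.1.1

/-! ### Regularity and polar parts of pole sums. -/

theorem measurable_poleSum (m : ℕ) (z ρ : ℕ → ℂ) (A : ℂ) : Measurable (poleSum m z ρ A) := by
  unfold poleSum
  fun_prop

theorem continuousAt_poleSum {m : ℕ} {z : ℕ → ℂ} (ρ : ℕ → ℂ) (A : ℂ) {x : ℂ}
    (hx : ∀ k < m, x ≠ z k) : ContinuousAt (poleSum m z ρ A) x := by
  unfold poleSum
  refine tendsto_finsetSum _ fun k hk => ?_
  have : x - z k ≠ 0 := sub_ne_zero.2 (hx k (Finset.mem_range.1 hk))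
  refine ContinuousAt.add (ContinuousAt.div (by fun_prop) (by fun_prop) (pow_ne_zero 2 this))
    (ContinuousAt.div (by fun_prop) (by fun_prop) this)

theorem analyticAt_poleSum {m : ℕ} {z : ℕ → ℂ} (ρ : ℕ → ℂ) (A : ℂ) {x : ℂ}
    (hx : ∀ k < m, x ≠ z k) : AnalyticAt ℂ (poleSum m z ρ A) x := by
  unfold poleSum
  refine Finset.analyticAt_fun_sum _ fun k hk => ?_
  have : x - z k ≠ 0 := sub_ne_zero.2 (hx k (Finset.mem_range.1 hk))
  refine AnalyticAt.add (AnalyticAt.div (by fun_prop) (by fun_prop) (pow_ne_zero 2 this))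
    (AnalyticAt.div (by fun_prop) (by fun_prop) this)

/-- Multiplying by the square of the distance to a pole leaves a continuous function. -/
theorem tendsto_sub_sq_mul_poleSum {m : ℕ} {z : ℕ → ℂ} (ρ : ℕ → ℂ) (A : ℂ) {i : ℕ} (hi : i < m)
    (hinj : ∀ k < m, k ≠ i → z k ≠ z i) :
    Tendsto (fun x => (x - z i) ^ 2 * poleSum m z ρ A x) (𝓝[≠] z i) (𝓝 A) := by
  set rest : ℂ → ℂ := fun x =>
    ∑ k ∈ (Finset.range m).erase i, (A / (x - z k) ^ 2 + ρ k / (x - z k)) with hrest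
  have hc : ContinuousAt rest (z i) := by
    refine tendsto_finsetSum _ fun k hk => ?_
    have hk' := Finset.mem_erase.1 hk
    have : z i - z k ≠ 0 := sub_ne_zero.2 (hinj k (Finset.mem_range.1 hk'.2) hk'.1).symm
    refine ContinuousAt.add (ContinuousAt.div (by fun_prop) (by fun_prop) (pow_ne_zero 2 this))
      (ContinuousAt.div (by fun_prop) (by fun_prop) this)
  have hg : ContinuousAt (fun x => A + (x - z i) * ρ i + (x - z i) ^ 2 * rest x) (z i) := by
    fun_prop
  have h1 : Tendsto (fun x => A + (x - z i) * ρ i + (x - z i) ^ 2 * rest x) (𝓝[≠] z i) (𝓝 A) := by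
    have := hg.tendsto.mono_left (nhdsWithin_le_nhds (s := {z i}ᶜ))
    simpa using this
  refine h1.congr' ?_
  filter_upwards [self_mem_nhdsWithin] with x hx
  have hx' : x - z i ≠ 0 := sub_ne_zero.2 hx
  rw [poleSum, ← Finset.add_sum_erase _ _ (Finset.mem_range.2 hi), mul_add]
  simp only [hrest]
  field_simp

/-- The residue is recovered when there is no double pole. -/
theorem tendsto_sub_mul_poleSum {m : ℕ} {z : ℕ → ℂ} (ρ : ℕ → ℂ) {i : ℕ} (hi : i < m)
    (hinj : ∀ k < m, k ≠ i → z k ≠ z i) :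
    Tendsto (fun x => (x - z i) * poleSum m z ρ 0 x) (𝓝[≠] z i) (𝓝 (ρ i)) := by
  set rest : ℂ → ℂ := fun x =>
    ∑ k ∈ (Finset.range m).erase i, (0 / (x - z k) ^ 2 + ρ k / (x - z k)) with hrest
  have hc : ContinuousAt rest (z i) := by
    refine tendsto_finsetSum _ fun k hk => ?_
    have hk' := Finset.mem_erase.1 hk
    have : z i - z k ≠ 0 := sub_ne_zero.2 (hinj k (Finset.mem_range.1 hk'.2) hk'.1).symm
    refine ContinuousAt.add (ContinuousAt.div (by fun_prop) (by fun_prop) (pow_ne_zero 2 this))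
      (ContinuousAt.div (by fun_prop) (by fun_prop) this)
  have hg : ContinuousAt (fun x => ρ i + (x - z i) * rest x) (z i) := by
    fun_prop
  have h1 : Tendsto (fun x => ρ i + (x - z i) * rest x) (𝓝[≠] z i) (𝓝 (ρ i)) := by
    have := hg.tendsto.mono_left (nhdsWithin_le_nhds (s := {z i}ᶜ))
    simpa using this
  refine h1.congr' ?_
  filter_upwards [self_mem_nhdsWithin] with x hx
  have hx' : x - z i ≠ 0 := sub_ne_zero.2 hx
  rw [poleSum, ← Finset.add_sum_erase _ _ (Finset.mem_range.2 hi), mul_add]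
  simp only [hrest]
  field_simp
  ring

/-- A pole sum that vanishes near some point has no poles. -/
theorem poleSum_eq_zero_imp {m : ℕ} {z ρ : ℕ → ℂ} {A : ℂ} {i : ℕ} (hi : i < m)
    (hinj : ∀ k < m, k ≠ i → z k ≠ z i) {x₀ : ℂ} (hx₀ : ∀ k < m, x₀ ≠ z k)
    (h : ∀ᶠ x in 𝓝 x₀, poleSum m z ρ A x = 0) : A = 0 ∧ ρ i = 0 := by
  set S : Set ℂ := z '' Set.Iio m with hS
  have hSf : S.Finite := (Set.finite_Iio m).image z
  have hmem : ∀ x, x ∈ Sᶜ → ∀ k < m, x ≠ z k := fun x hx k hk e => hx ⟨k, hk, e.symm⟩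
  -- The complement of finitely many points is connected, so the identity theorem spreads the zero
  -- up to the poles.
  have hconn : IsPreconnected Sᶜ :=
    (hSf.countable.isPathConnected_compl_of_one_lt_rank
      (by simp)).isConnected.isPreconnected
  have hx₀S : x₀ ∈ Sᶜ := by rintro ⟨k, hk, e⟩; exact hx₀ k hk e.symm
  have hz : Set.EqOn (poleSum m z ρ A) (fun _ => 0) Sᶜ :=
    AnalyticOnNhd.eqOn_of_preconnected_of_eventuallyEq
      (fun x hx => analyticAt_poleSum ρ A (hmem x hx)) (fun x _ => analyticAt_const) hconn hx₀S h
  have hev : ∀ᶠ x in 𝓝[≠] z i, x ∈ Sᶜ := by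
    have h1 : (S \ {z i})ᶜ ∈ 𝓝 (z i) := (hSf.subset Set.sdiff_subset).isClosed.isOpen_compl.mem_nhds
      (by simp)
    filter_upwards [nhdsWithin_le_nhds h1, self_mem_nhdsWithin] with x hx hx' hxS
    exact hx ⟨hxS, hx'⟩
  have hA : A = 0 := by
    refine tendsto_nhds_unique (tendsto_sub_sq_mul_poleSum ρ A hi hinj) ?_
    refine tendsto_const_nhds.congr' ?_
    filter_upwards [hev] with x hx
    simp [hz hx]
  subst hA
  refine ⟨rfl, tendsto_nhds_unique (tendsto_sub_mul_poleSum ρ hi hinj) ?_⟩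
  refine tendsto_const_nhds.congr' ?_
  filter_upwards [hev] with x hx
  simp [hz hx]

/-! ### Rigidity on a cycle whose multiplier has modulus one. -/

/-- The mass of a quadratic differential with at most a double pole at `a` on the part of a small
disc that `f` does not map into the disc of the scaled radius. -/
theorem lintegral_ball_diff_preimage_le {f q S : ℂ → ℂ} {a b : ℂ} {M r : ℝ} (hr : 0 < r)
    (hfS : ∀ x, f x - b = (x - a) * S x) (hS : DifferentiableAt ℂ S a) (hSa : S a ≠ 0)
    (hq : ∀ᶠ x in 𝓝[≠] a, ‖(x - a) ^ 2 * q x‖ ≤ M) :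
    ∃ C : ℝ, ∀ᶠ ε in 𝓝[>] (0 : ℝ),
      ∫⁻ x in Metric.ball a (r * ε) ∩ f ⁻¹' (Metric.ball b (r * ‖S a‖ * ε))ᶜ, ‖q x‖ₑ ≤
        ENNReal.ofReal (C * ε) := by
  have hδ : 0 < ‖S a‖ := norm_pos_iff.2 hSa
  obtain ⟨K, hK0, hK⟩ := hS.isBigO_sub.exists_pos
  rw [Asymptotics.IsBigOWith] at hK
  obtain ⟨η₁, hη₁, h₁⟩ := Metric.eventually_nhds_iff.1 hK
  obtain ⟨η₂, hη₂, h₂⟩ := Metric.eventually_nhds_iff.1 (eventually_nhdsWithin_iff.1 hq)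
  -- From $|S(x)|\le|S(a)|+K|x-a|$, a point of the disc whose image leaves the target disc satisfies
  -- $|x-a|\ge r\varepsilon-K'\varepsilon^2$.
  set K' : ℝ := K * r ^ 2 / ‖S a‖ with hK'
  have hK'0 : 0 < K' := by positivity
  set M' : ℝ := max M 0
  -- On this annulus $|q|\le4M'/(r\varepsilon)^2$, because its inner radius is at least
  -- $r\varepsilon/2$, and its area is at most $2\pi\,r\varepsilon\,K'\varepsilon^2$. The product is
  -- $C\varepsilon$.
  refine ⟨8 * Real.pi * M' * K' / r, ?_⟩
  have e1 : ∀ᶠ ε in 𝓝[>] (0 : ℝ), 0 < ε := self_mem_nhdsWithin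
  have e2 : ∀ c > (0 : ℝ), ∀ᶠ ε in 𝓝[>] (0 : ℝ), ε < c := fun c hc =>
    nhdsWithin_le_nhds (eventually_lt_nhds hc)
  filter_upwards [e1, e2 (η₁ / r) (by positivity), e2 (η₂ / r) (by positivity),
    e2 (r / (2 * K')) (by positivity)] with ε hε he1 he2 he3
  rw [lt_div_iff₀ hr] at he1 he2
  rw [lt_div_iff₀ (by positivity)] at he3
  set T : Set ℂ := Metric.ball a (r * ε) \ Metric.ball a (r * ε - K' * ε ^ 2) with hT
  have hTm : MeasurableSet T := measurableSet_ball.diff measurableSet_ball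
  have hr' : r * ε / 2 ≤ r * ε - K' * ε ^ 2 := by nlinarith
  have hsub : Metric.ball a (r * ε) ∩ f ⁻¹' (Metric.ball b (r * ‖S a‖ * ε))ᶜ ⊆ T := by
    rintro x ⟨hx1, hx2⟩
    refine ⟨hx1, fun hx3 => ?_⟩
    rw [Metric.mem_ball, dist_eq_norm] at hx1 hx3
    simp only [Set.mem_preimage, Set.mem_compl_iff, Metric.mem_ball, dist_eq_norm, not_lt] at hx2
    rw [hfS, norm_mul] at hx2
    have h3 := h₁ (y := x) (by rw [dist_eq_norm]; nlinarith)
    have h4 : ‖S x‖ ≤ ‖S a‖ + K * ‖x - a‖ := by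
      have := norm_le_norm_add_norm_sub' (S x) (S a)
      linarith
    have h5 : ‖x - a‖ * ‖S x‖ ≤ ‖x - a‖ * ‖S a‖ + K * (r * ε) ^ 2 := by
      have h6 := mul_le_mul_of_nonneg_left h4 (norm_nonneg (x - a))
      have h7 : ‖x - a‖ ^ 2 ≤ (r * ε) ^ 2 := pow_le_pow_left₀ (norm_nonneg _) hx1.le 2
      nlinarith
    have h8 : ‖x - a‖ * ‖S a‖ < (r * ε - K' * ε ^ 2) * ‖S a‖ := mul_lt_mul_of_pos_right hx3 hδ
    have h9 : K' * ‖S a‖ = K * r ^ 2 := by rw [hK']; field_simp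
    have h10 : K' * ε ^ 2 * ‖S a‖ = K * (r * ε) ^ 2 := by
      rw [mul_right_comm, h9]; ring
    nlinarith
  have hqb : ∀ x ∈ T, ‖q x‖ₑ ≤ ENNReal.ofReal (4 * M' / (r * ε) ^ 2) := by
    rintro x ⟨hx1, hx2⟩
    rw [Metric.mem_ball, dist_eq_norm] at hx1 hx2
    have h3 : r * ε / 2 ≤ ‖x - a‖ := by linarith
    have hpos : 0 < r * ε / 2 := by positivity
    have h4 : ‖(x - a) ^ 2 * q x‖ ≤ M := h₂ (by rw [dist_eq_norm]; linarith)
      (sub_ne_zero.1 (norm_pos_iff.1 (hpos.trans_le h3)))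
    rw [norm_mul, norm_pow] at h4
    rw [← ofReal_norm]
    refine ENNReal.ofReal_le_ofReal ?_
    rw [le_div_iff₀ (by positivity)]
    have h5 : (r * ε / 2) ^ 2 ≤ ‖x - a‖ ^ 2 := pow_le_pow_left₀ hpos.le h3 2
    have h6 := mul_le_mul_of_nonneg_right h5 (norm_nonneg (q x))
    have h7 : M ≤ M' := le_max_left _ _
    nlinarith
  have hr'0 : 0 ≤ r * ε - K' * ε ^ 2 := by
    have : 0 < r * ε := by positivity
    linarith
  have hvol : volume T = ENNReal.ofReal (Real.pi * ((r * ε) ^ 2 - (r * ε - K' * ε ^ 2) ^ 2)) := by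
    rw [hT, measure_sdiff (Metric.ball_subset_ball (by nlinarith [sq_nonneg ε]))
      measurableSet_ball.nullMeasurableSet (by rw [Complex.volume_ball]; finiteness),
      Complex.volume_ball, Complex.volume_ball, ← ENNReal.ofReal_pow (by positivity), ← ENNReal.ofReal_pow hr'0, mul_sub,
      ENNReal.ofReal_sub _ (by positivity),
      mul_comm Real.pi, mul_comm Real.pi, ENNReal.ofReal_mul (by positivity),
      ENNReal.ofReal_mul (by positivity)]
    simp [← NNReal.coe_real_pi, ENNReal.ofReal_coe_nnreal]
  calc _ ≤ ∫⁻ x in T, ‖q x‖ₑ := lintegral_mono_set hsub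
    _ ≤ ∫⁻ _ in T, ENNReal.ofReal (4 * M' / (r * ε) ^ 2) := setLIntegral_mono' hTm hqb
    _ = ENNReal.ofReal (4 * M' / (r * ε) ^ 2) * volume T := setLIntegral_const _ _
    _ ≤ _ := by
        have hM' : 0 ≤ M' := le_max_right _ _
        rw [hvol, ← ENNReal.ofReal_mul (by positivity)]
        refine ENNReal.ofReal_le_ofReal ?_
        have h1 : (r * ε) ^ 2 - (r * ε - K' * ε ^ 2) ^ 2 ≤ 2 * (r * ε) * (K' * ε ^ 2) := by
          nlinarith [sq_nonneg (K' * ε ^ 2)]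
        calc _ ≤ 4 * M' / (r * ε) ^ 2 * (Real.pi * (2 * (r * ε) * (K' * ε ^ 2))) := by gcongr
          _ = _ := by field_simp; ring

theorem lintegral_biUnion_finset_le {ι : Type*} (s : Finset ι) (t : ι → Set ℂ) (g : ℂ → ENNReal) :
    ∫⁻ x in ⋃ i ∈ s, t i, g x ≤ ∑ i ∈ s, ∫⁻ x in t i, g x := by
  classical
  induction s using Finset.induction_on with
  | empty => simp
  | insert i s hi ih =>
    rw [Finset.set_biUnion_insert, Finset.sum_insert hi]
    exact (lintegral_union_le _ _ _).trans (add_le_add le_rfl ih)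

theorem pow_sub_pow_eq_mul_geom_sum (d : ℕ) (a x : ℂ) :
    x ^ d - a ^ d = (x - a) * ∑ i ∈ Finset.range d, x ^ i * a ^ (d - 1 - i) := by
  rw [mul_comm, geom_sum₂_mul]

theorem geom_sum_self (d : ℕ) (a : ℂ) :
    ∑ i ∈ Finset.range d, a ^ i * a ^ (d - 1 - i) = d * a ^ (d - 1) := by
  rw [geom_sum₂_self]

/-- Rigidity of a cycle whose multiplier has modulus one: the only quadratic differential with
poles on the cycle, of order at most two, that is fixed by the push-forward is zero. -/
theorem pole_coeff_eq_zero_of_cycle {d m : ℕ} (hd : 2 ≤ d) (hm : 0 < m) {c A : ℂ} {z ρ : ℕ → ℂ}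
    (hz : ∀ k, z (k + 1) = z k ^ d + c) (hzm : z m = z 0)
    (hinj : ∀ i < m, ∀ k < m, k ≠ i → z k ≠ z i)
    (hmul : ‖∏ k ∈ Finset.range m, (d * z k ^ (d - 1))‖ = 1)
    (hρ : ∀ k, ρ (k + 1) = ρ k / (d * z k ^ (d - 1)) - A * (d - 1) / (d * z k ^ d))
    (hρm : ρ m = ρ 0) (hsum : ∑ k ∈ Finset.range m, ρ k = 0) : A = 0 ∧ ρ 0 = 0 := by
  have hd0 : d ≠ 0 := by omega
  have hδ0 : ∀ k < m, d * z k ^ (d - 1) ≠ 0 := by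
    intro k hk h
    rw [Finset.prod_eq_zero (Finset.mem_range.2 hk) h] at hmul
    simp at hmul
  have hz0 : ∀ k < m, z k ≠ 0 := by
    intro k hk h
    apply hδ0 k hk
    rw [h, zero_pow (by omega), mul_zero]
  set q := poleSum m z ρ A with hq
  set f : ℂ → ℂ := fun x => x ^ d + c with hf
  have hfc : Continuous f := by fun_prop
  -- Large enough that `V` contains the cycle and $f^{-1}(V)$, and that the point $R-1$ of `V` is
  -- mapped outside `V`.
  set R : ℝ := 3 + ‖c‖ + ∑ k ∈ Finset.range m, ‖z k‖ with hR
  have hsum0 : 0 ≤ ∑ k ∈ Finset.range m, ‖z k‖ := Finset.sum_nonneg fun _ _ => norm_nonneg _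
  have hc0 := norm_nonneg c
  have hzR : ∀ k < m, ‖z k‖ < R := by
    intro k hk
    have := Finset.single_le_sum (f := fun k => ‖z k‖) (fun _ _ => norm_nonneg _)
      (Finset.mem_range.2 hk)
    linarith
  have hzR' : ∀ k < m, ‖z (k + 1)‖ < R := by
    intro k hk
    rcases Nat.lt_or_ge (k + 1) m with h | h
    · exact hzR _ h
    · rw [show k + 1 = m by omega, hzm]; exact hzR 0 hm
  set V : Set ℂ := Metric.ball 0 R with hV
  have hVf : f ⁻¹' V ⊆ V := by
    intro x hx
    simp only [hV, Set.mem_preimage, mem_ball_zero_iff] at hx ⊢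
    by_contra! h
    have h1 : ‖x‖ ^ 2 ≤ ‖x‖ ^ d := pow_le_pow_right₀ (by linarith) hd
    have h2 : ‖x‖ ^ d ≤ ‖f x‖ + ‖c‖ := by
      rw [← norm_pow]
      have := norm_sub_le (f x) c
      simpa [hf] using this
    nlinarith
  -- To first order `f` maps the disc of radius `r k * ε` onto the next one; `hmul` makes the radii
  -- close up after one turn.
  set r : ℕ → ℝ := fun k => ∏ j ∈ Finset.range k, ‖(d * z j ^ (d - 1) : ℂ)‖ with hr
  have hrpos : ∀ k ≤ m, 0 < r k := fun k hk => Finset.prod_pos fun j hj =>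
    norm_pos_iff.2 (hδ0 j (by have := Finset.mem_range.1 hj; omega))
  have hr1 : ∀ k, r (k + 1) = r k * ‖(d * z k ^ (d - 1) : ℂ)‖ := fun k => Finset.prod_range_succ _ _
  have hrm : r m = r 0 := by
    simp only [hr, ← norm_prod, hmul]
    simp
  set U : ℝ → Set ℂ := fun ε => ⋃ k ∈ Finset.range m, Metric.ball (z k) (r k * ε) with hU
  have hUo : ∀ ε, IsOpen (U ε) := fun ε => isOpen_biUnion fun _ _ => Metric.isOpen_ball
  -- The leak: points of the removed discs whose image escapes the next removed disc.
  set N : ℕ → ℝ → Set ℂ := fun k ε =>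
    Metric.ball (z k) (r k * ε) ∩ f ⁻¹' (Metric.ball (z (k + 1)) (r (k + 1) * ε))ᶜ with hN
  have hpre : ∀ ε, f ⁻¹' (V \ U ε) ⊆ (f ⁻¹' V \ U ε) ∪ ⋃ k ∈ Finset.range m, N k ε := by
    rintro ε x ⟨hx1, hx2⟩
    by_cases hxU : x ∈ U ε
    · right
      simp only [hU, Set.mem_iUnion, Finset.mem_range, exists_prop, not_exists, not_and] at hxU hx2
      obtain ⟨k, hk, hxk⟩ := hxU
      simp only [Set.mem_iUnion, Finset.mem_range, exists_prop]
      refine ⟨k, hk, hxk, ?_⟩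
      rcases Nat.lt_or_ge (k + 1) m with h | h
      · exact hx2 _ h
      · have := hx2 0 hm
        rw [show k + 1 = m by omega, hzm, hrm]
        exact this
    · exact Or.inl ⟨hx1, hxU⟩
  -- A disc of `V` on which `q` will be shown to vanish. The factor `2` keeps it disjoint from the
  -- removed discs once their radii are below `s`.
  obtain ⟨s, hs, hsO, hsz⟩ : ∃ s > 0, Metric.ball ((R - 1 : ℝ) : ℂ) s ⊆ V \ f ⁻¹' V ∧
      ∀ k < m, 2 * s < dist ((R - 1 : ℝ) : ℂ) (z k) := by
    set x₀ : ℂ := ((R - 1 : ℝ) : ℂ) with hx₀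
    have hx₀n : ‖x₀‖ = R - 1 := by
      rw [hx₀, Complex.norm_real, Real.norm_of_nonneg (by linarith)]
    have hfx₀ : R < ‖f x₀‖ := by
      have h1 : ‖x₀‖ ^ 2 ≤ ‖x₀‖ ^ d := pow_le_pow_right₀ (by linarith) hd
      have h2 : ‖x₀‖ ^ d ≤ ‖f x₀‖ + ‖c‖ := by
        rw [← norm_pow]
        have := norm_sub_le (f x₀) c
        simpa [hf] using this
      nlinarith
    have hO : ∀ᶠ x in 𝓝 x₀, x ∈ V \ f ⁻¹' V := by
      have h1 : ∀ᶠ x in 𝓝 x₀, ‖x‖ < R :=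
        continuous_norm.continuousAt.eventually_lt continuousAt_const (by linarith)
      have h2 : ∀ᶠ x in 𝓝 x₀, R < ‖f x‖ :=
        continuousAt_const.eventually_lt (by fun_prop) hfx₀
      filter_upwards [h1, h2] with x hx1 hx2
      refine ⟨by simpa [hV] using hx1, fun h => ?_⟩
      simp only [hV, Set.mem_preimage, mem_ball_zero_iff] at h
      linarith
    obtain ⟨s₁, hs₁, hb⟩ := Metric.eventually_nhds_iff_ball.1 hO
    have e1 : ∀ᶠ s in 𝓝[>] (0 : ℝ), ∀ k ∈ Finset.range m, 2 * s < dist x₀ (z k) := by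
      rw [eventually_all_finset]
      intro k hk
      have hne : x₀ ≠ z k := by
        intro h
        have := hzR' k (Finset.mem_range.1 hk)
        rw [hz, ← h] at this
        exact absurd this (not_lt.2 hfx₀.le)
      have : ∀ᶠ s in 𝓝 (0 : ℝ), 2 * s < dist x₀ (z k) :=
        ContinuousAt.eventually_lt (by fun_prop) continuousAt_const
          (by simpa using hne)
      exact nhdsWithin_le_nhds this
    have e2 : ∀ᶠ s in 𝓝[>] (0 : ℝ), s < s₁ := nhdsWithin_le_nhds (eventually_lt_nhds hs₁)
    have e3 : ∀ᶠ s in 𝓝[>] (0 : ℝ), 0 < s := self_mem_nhdsWithin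
    obtain ⟨s, h1, h2, h3⟩ := (e1.and (e2.and e3)).exists
    exact ⟨s, h3, fun x hx => hb x (Metric.ball_subset_ball h2.le hx),
      fun k hk => h1 k (Finset.mem_range.2 hk)⟩
  set B := Metric.ball ((R - 1 : ℝ) : ℂ) s with hB
  set ω := Complex.exp (2 * Real.pi * Complex.I / d) with hω
  have hωp : IsPrimitiveRoot ω d := Complex.isPrimitiveRoot_exp d hd0
  have hpush : ∀ ε, ∫⁻ w in V \ U ε, ‖q w‖ₑ ≤ ∫⁻ x in f ⁻¹' (V \ U ε), ‖q x‖ₑ := by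
    intro ε
    refine lintegral_le_lintegral_preimage hd0 hωp (measurable_poleSum m z ρ A)
      (S := insert c ((fun k => z (k + 1)) '' Set.Iio m))
      (measurableSet_ball.diff (hUo ε).measurableSet)
      (((Set.finite_Iio m).image _).insert c).countable ?_
    intro w hw g hg
    simp only [Set.mem_insert_iff, Set.mem_image, Set.mem_Iio, not_or, not_exists, not_and] at hw
    exact poleSum_pushforward hd hz hzm hz0 hρ hρm hsum hωp hg hw.1
      fun k hk h => hw.2 k hk h.symm
  have hfin : ∀ ε > 0, ∫⁻ w in V \ U ε, ‖q w‖ₑ < ⊤ := by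
    intro ε hε
    have hcpt : IsCompact (Metric.closedBall (0 : ℂ) R \ U ε) :=
      (isCompact_closedBall 0 R).diff (hUo ε)
    have hcont : ContinuousOn q (Metric.closedBall (0 : ℂ) R \ U ε) := by
      intro x hx
      refine (continuousAt_poleSum ρ A fun k hk h => hx.2 ?_).continuousWithinAt
      simp only [hU, Set.mem_iUnion, Finset.mem_range, exists_prop]
      exact ⟨k, hk, by rw [h]; exact Metric.mem_ball_self (mul_pos (hrpos k hk.le) hε)⟩
    have hint := hcont.integrableOn_compact (μ := volume) hcpt
    exact (lintegral_mono_set (Set.sdiff_subset_sdiff_left Metric.ball_subset_closedBall)).trans_lt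
      hint.2
  have hkey : ∀ᶠ ε in 𝓝[>] (0 : ℝ), ∫⁻ x in B, ‖q x‖ₑ ≤
      ∑ k ∈ Finset.range m, ∫⁻ x in N k ε, ‖q x‖ₑ := by
    have e1 : ∀ᶠ ε in 𝓝[>] (0 : ℝ), 0 < ε := self_mem_nhdsWithin
    have e2 : ∀ᶠ ε in 𝓝[>] (0 : ℝ), ∀ k ∈ Finset.range m, r k * ε < s := by
      rw [eventually_all_finset]
      intro k hk
      have : ∀ᶠ ε in 𝓝 (0 : ℝ), r k * ε < s :=
        ContinuousAt.eventually_lt (by fun_prop) continuousAt_const (by simpa using hs)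
      exact nhdsWithin_le_nhds this
    filter_upwards [e1, e2] with ε hε hεs
    have hBU : Disjoint B (U ε) := by
      refine Set.disjoint_left.2 fun x hx hxU => ?_
      simp only [hU, Set.mem_iUnion, Finset.mem_range, exists_prop] at hxU
      obtain ⟨k, hk, hxk⟩ := hxU
      have h1 := hsz k hk
      have h2 := hεs k (Finset.mem_range.2 hk)
      rw [hB, Metric.mem_ball'] at hx
      rw [Metric.mem_ball] at hxk
      have := dist_triangle ((R - 1 : ℝ) : ℂ) x (z k)
      linarith
    have hdis : Disjoint B (f ⁻¹' V \ U ε) :=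
      Set.disjoint_left.2 fun x hx hx' => (hsO hx).2 hx'.1
    have hm1 : MeasurableSet (f ⁻¹' V \ U ε) :=
      (hfc.measurable measurableSet_ball).diff (hUo ε).measurableSet
    have hle : B ∪ (f ⁻¹' V \ U ε) ⊆ V \ U ε :=
      Set.union_subset (fun x hx => ⟨(hsO hx).1, Set.disjoint_left.1 hBU hx⟩)
        (Set.sdiff_subset_sdiff_left hVf)
    have h1 : (∫⁻ x in B, ‖q x‖ₑ) + ∫⁻ x in f ⁻¹' V \ U ε, ‖q x‖ₑ ≤
        (∑ k ∈ Finset.range m, ∫⁻ x in N k ε, ‖q x‖ₑ) + ∫⁻ x in f ⁻¹' V \ U ε, ‖q x‖ₑ := by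
      calc _ = ∫⁻ x in B ∪ (f ⁻¹' V \ U ε), ‖q x‖ₑ := (lintegral_union hm1 hdis).symm
        _ ≤ ∫⁻ x in V \ U ε, ‖q x‖ₑ := lintegral_mono_set hle
        _ ≤ ∫⁻ x in f ⁻¹' (V \ U ε), ‖q x‖ₑ := hpush ε
        _ ≤ ∫⁻ x in (f ⁻¹' V \ U ε) ∪ ⋃ k ∈ Finset.range m, N k ε, ‖q x‖ₑ :=
          lintegral_mono_set (hpre ε)
        _ ≤ (∫⁻ x in f ⁻¹' V \ U ε, ‖q x‖ₑ) + ∫⁻ x in ⋃ k ∈ Finset.range m, N k ε, ‖q x‖ₑ :=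
          lintegral_union_le _ _ _
        _ ≤ (∫⁻ x in f ⁻¹' V \ U ε, ‖q x‖ₑ) + ∑ k ∈ Finset.range m, ∫⁻ x in N k ε, ‖q x‖ₑ := by
          gcongr
          exact lintegral_biUnion_finset_le _ _ _
        _ = _ := add_comm _ _
    -- Cancellation needs a finite mass, which is why the poles were cut out.
    refine ENNReal.le_of_add_le_add_right ?_ h1
    exact ((lintegral_mono_set (Set.sdiff_subset_sdiff_left hVf)).trans_lt (hfin ε hε)).ne
  have hN0 : ∀ k < m, Tendsto (fun ε => ∫⁻ x in N k ε, ‖q x‖ₑ) (𝓝[>] (0 : ℝ)) (𝓝 0) := by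
    intro k hk
    set S : ℂ → ℂ := fun x => ∑ i ∈ Finset.range d, x ^ i * z k ^ (d - 1 - i) with hS
    have hSk : S (z k) = d * z k ^ (d - 1) := geom_sum_self d (z k)
    have hlim := (tendsto_sub_sq_mul_poleSum ρ A hk (hinj k hk)).norm
    obtain ⟨C, hC⟩ := lintegral_ball_diff_preimage_le (f := f) (q := q) (S := S) (a := z k)
      (b := z (k + 1)) (M := ‖A‖ + 1) (hrpos k hk.le)
      (fun x => by rw [hz, ← pow_sub_pow_eq_mul_geom_sum]; simp [hf])
      (by fun_prop) (by rw [hSk]; exact hδ0 k hk)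
      ((hlim.eventually_lt_const (lt_add_one _)).mono fun _ h => h.le)
    rw [hSk, ← hr1] at hC
    refine tendsto_of_tendsto_of_tendsto_of_le_of_le' tendsto_const_nhds ?_
      (Eventually.of_forall fun _ => zero_le) hC
    have : Tendsto (fun ε : ℝ => ENNReal.ofReal (C * ε)) (𝓝 0) (𝓝 (ENNReal.ofReal (C * 0))) :=
      (ENNReal.continuous_ofReal.comp (continuous_const.mul continuous_id)).tendsto 0
    rw [mul_zero, ENNReal.ofReal_zero] at this
    exact this.mono_left nhdsWithin_le_nhds
  have hB0 : ∫⁻ x in B, ‖q x‖ₑ = 0 := by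
    have h1 : Tendsto (fun ε => ∑ k ∈ Finset.range m, ∫⁻ x in N k ε, ‖q x‖ₑ) (𝓝[>] (0 : ℝ))
        (𝓝 (∑ k ∈ Finset.range m, 0)) :=
      tendsto_finsetSum _ fun k hk => hN0 k (Finset.mem_range.1 hk)
    rw [Finset.sum_const_zero] at h1
    exact le_antisymm (ge_of_tendsto h1 hkey) (zero_le)
  have hBz : ∀ x ∈ B, ∀ k < m, x ≠ z k := by
    rintro x hx k hk rfl
    have := hsz k hk
    rw [hB, Metric.mem_ball'] at hx
    linarith
  have hq0 : ∀ x ∈ B, q x = 0 := by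
    have hae : q =ᵐ[volume.restrict B] fun _ => 0 := by
      have := (lintegral_eq_zero_iff (measurable_poleSum m z ρ A).enorm).1 hB0
      filter_upwards [this] with x hx
      simpa using hx
    exact Measure.eqOn_of_ae_eq hae
      (fun x hx => (continuousAt_poleSum ρ A (hBz x hx)).continuousWithinAt) continuousOn_const
      (by rw [Metric.isOpen_ball.interior_eq]; exact subset_closure)
  exact poleSum_eq_zero_imp hm (hinj 0 hm) (hBz _ (Metric.mem_ball_self hs))
    (Filter.eventually_of_mem (Metric.ball_mem_nhds _ hs) hq0)

/-! ### Orbits as functions of parameter and point; transversality. -/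

/-- The `k`-th iterate of `f_c` at `x`, as a function of the pair `(c, x)`. -/
def orbit (d k : ℕ) (p : ℂ × ℂ) : ℂ := (unicritical d p.1)^[k] p.2

theorem orbit_zero (d : ℕ) (p : ℂ × ℂ) : orbit d 0 p = p.2 := rfl

theorem orbit_succ (d k : ℕ) (p : ℂ × ℂ) : orbit d (k + 1) p = orbit d k p ^ d + p.1 := by
  rw [orbit, Function.iterate_succ_apply']
  rfl

theorem orbit_add (d k l : ℕ) (p : ℂ × ℂ) :
    orbit d (k + l) p = orbit d k (p.1, orbit d l p) :=
  Function.iterate_add_apply _ _ _ _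

theorem analyticAt_orbit (d k : ℕ) (p : ℂ × ℂ) : AnalyticAt ℂ (orbit d k) p := by
  induction k with
  | zero => exact analyticAt_snd
  | succ k ih =>
    have : orbit d (k + 1) = fun p => orbit d k p ^ d + p.1 := funext fun p => orbit_succ d k p
    rw [this]
    exact (ih.pow d).add analyticAt_fst

theorem continuous_orbit (d k : ℕ) : Continuous (orbit d k) :=
  continuous_iff_continuousAt.2 fun p => (analyticAt_orbit d k p).continuousAt

theorem hasDerivAt_orbit (d k : ℕ) (c x : ℂ) :
    HasDerivAt (fun y => orbit d k (c, y))
      (∏ j ∈ Finset.range k, (d * orbit d j (c, x) ^ (d - 1))) x := by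
  induction k with
  | zero => simpa [orbit_zero] using hasDerivAt_id' x
  | succ k ih =>
    simp_rw [orbit_succ]
    refine ((ih.pow d).add_const c).congr_deriv ?_
    rw [Finset.prod_range_succ]
    ring

theorem multiplier_eq_prod (d k : ℕ) (c x : ℂ) :
    multiplier (unicritical d c) k x =
      ∏ j ∈ Finset.range k, (d * orbit d j (c, x) ^ (d - 1)) :=
  (hasDerivAt_orbit d k c x).deriv

/-- The derivative of the orbit along a curve `c ↦ (c, α c)`. -/
theorem hasDerivAt_orbit_curve {d : ℕ} {α : ℂ → ℂ} {c : ℂ} {D : ℕ → ℂ}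
    (hα : HasDerivAt α (D 0) c)
    (hD : ∀ k, D (k + 1) = d * orbit d k (c, α c) ^ (d - 1) * D k + 1) (k : ℕ) :
    HasDerivAt (fun b => orbit d k (b, α b)) (D k) c := by
  induction k with
  | zero => exact hα
  | succ k ih =>
    simp_rw [orbit_succ]
    exact ((ih.pow d).add (hasDerivAt_id c)).congr_deriv (hD k).symm

theorem HasPeriod.orbit_injOn {d m : ℕ} {c x : ℂ} (h : HasPeriod (unicritical d c) m x) :
    ∀ i < m, ∀ k < m, k ≠ i → orbit d k (c, x) ≠ orbit d i (c, x) := by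
  have key : ∀ i k, i < k → k < m → orbit d k (c, x) ≠ orbit d i (c, x) := by
    intro i k hik hk he
    have h1 : orbit d (m - k + i) (c, x) = x := by
      rw [orbit_add, ← he, ← orbit_add, Nat.sub_add_cancel hk.le]
      exact h.2.1
    exact h.2.2 (m - k + i) (by omega) (by omega) h1
  intro i hi k hk hki
  rcases lt_or_gt_of_ne hki with hlt | hlt
  · exact (key k i hlt hi).symm
  · exact key i k hlt hk

/-- Transversality at a cycle of multiplier one: the `n`-th iterate moves with the parameter. -/
theorem deriv_orbit_param_ne_zero {d n : ℕ} (hd : 2 ≤ d) {c x : ℂ}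
    (h : HasPeriod (unicritical d c) n x) (hmul : multiplier (unicritical d c) n x = 1) :
    deriv (fun b => orbit d n (b, x)) c ≠ 0 := by
  intro h0
  rw [multiplier_eq_prod] at hmul
  set z : ℕ → ℂ := fun k => orbit d k (c, x) with hz
  set δ : ℕ → ℂ := fun k => d * z k ^ (d - 1) with hδ
  set D : ℕ → ℂ := fun k => Nat.rec 0 (fun k y => δ k * y + 1) k with hD
  have hDn : D n = 0 := by
    rw [← h0]
    exact (hasDerivAt_orbit_curve (α := fun _ => x) (D := D) (hasDerivAt_const c x)
      (fun k => rfl) n).deriv.symm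
  have hδ0 : ∀ k < n, δ k ≠ 0 := by
    intro k hk h
    rw [Finset.prod_eq_zero (Finset.mem_range.2 hk) h] at hmul
    exact zero_ne_one hmul
  -- The residues $1/(f^{\circ k})'(x)$. Multiplying the recursion of `D` by `ρ (k + 1)` makes it
  -- telescope, so that $\sum\rho_k$ is the parameter derivative `D n`.
  set ρ : ℕ → ℂ := fun k => ∏ j ∈ Finset.range k, (δ j)⁻¹ with hρ
  have hρs : ∀ k, ρ (k + 1) = ρ k / δ k := fun k => by
    simp only [hρ, Finset.prod_range_succ, div_eq_mul_inv]
  have hρn : ρ n = 1 := by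
    simp only [hρ, Finset.prod_inv_distrib]
    exact inv_eq_one.2 hmul
  have hρ0 : ρ 0 = 1 := Finset.prod_range_zero _
  have htel : ∀ k ≤ n, ρ k * D k = ∑ j ∈ Finset.range k, ρ (j + 1) := by
    intro k
    induction k with
    | zero => simp [hD]
    | succ k ih =>
      intro hk
      rw [Finset.sum_range_succ, ← ih (by omega)]
      have e : D (k + 1) = δ k * D k + 1 := rfl
      rw [e, hρs]
      have := hδ0 k (by omega)
      field_simp
  have hsum : ∑ k ∈ Finset.range n, ρ k = 0 := by
    rw [← sum_range_shift (g := ρ) (hρn.trans hρ0.symm), ← htel n le_rfl, hDn, mul_zero]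
  have := pole_coeff_eq_zero_of_cycle (A := 0) hd h.1 (fun k => orbit_succ d k (c, x)) h.2.1
    h.orbit_injOn (by rw [hmul, norm_one]) (ρ := ρ) (fun k => by simpa using hρs k)
    (hρn.trans hρ0.symm) hsum
  exact one_ne_zero (hρ0.symm.trans this.2)

/-- Transversality at an indifferent cycle of multiplier different from one: the multiplier moves
with the parameter. -/
theorem deriv_multiplier_ne_zero {d m : ℕ} (hd : 2 ≤ d) {c : ℂ} {α : ℂ → ℂ} {α' : ℂ}
    (h : HasPeriod (unicritical d c) m (α c)) (hα : HasDerivAt α α' c)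
    (hper : ∀ᶠ b in 𝓝 c, orbit d m (b, α b) = α b)
    (hmul : ‖multiplier (unicritical d c) m (α c)‖ = 1)
    (hmul1 : multiplier (unicritical d c) m (α c) ≠ 1) :
    deriv (fun b => ∏ k ∈ Finset.range m, (d * orbit d k (b, α b) ^ (d - 1))) c ≠ 0 := by
  intro h0
  have hd0 : (d : ℂ) ≠ 0 := by exact_mod_cast (by omega : d ≠ 0)
  rw [multiplier_eq_prod] at hmul hmul1
  set z : ℕ → ℂ := fun k => orbit d k (c, α c) with hz
  set δ : ℕ → ℂ := fun k => d * z k ^ (d - 1) with hδ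
  set D : ℕ → ℂ := fun k => Nat.rec α' (fun k y => δ k * y + 1) k with hD
  have hDs : ∀ k, D (k + 1) = δ k * D k + 1 := fun k => rfl
  have hDer : ∀ k, HasDerivAt (fun b => orbit d k (b, α b)) (D k) c :=
    hasDerivAt_orbit_curve hα fun k => rfl
  have hDm : D m = D 0 := by
    have : HasDerivAt α (D m) c := (hDer m).congr_of_eventuallyEq (hper.mono fun b hb => hb.symm)
    exact this.unique hα
  have hlam0 : ∏ k ∈ Finset.range m, δ k ≠ 0 := by
    intro h
    rw [show (∏ k ∈ Finset.range m, (d * orbit d k (c, α c) ^ (d - 1)) : ℂ) = 0 from h] at hmul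
    simp at hmul
  have hδ0 : ∀ k < m, δ k ≠ 0 := fun k hk =>
    Finset.prod_ne_zero_iff.1 hlam0 k (Finset.mem_range.2 hk)
  have hz0 : ∀ k < m, z k ≠ 0 := by
    intro k hk h
    apply hδ0 k hk
    simp only [hδ, h, zero_pow (show d - 1 ≠ 0 by omega), mul_zero]
  set τ : ℕ → ℂ := fun k => (d - 1) / (d * z k ^ d) with hτ
  set B : ℕ → ℂ := fun k => Nat.rec 0 (fun k y => y / δ k - τ k) k with hB
  have hBs : ∀ k, B (k + 1) = B k / δ k - τ k := fun k => rfl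
  set Q : ℕ → ℂ := fun k => ∏ j ∈ Finset.range k, (δ j)⁻¹ with hQ
  have hQs : ∀ k, Q (k + 1) = Q k / δ k := fun k => by
    simp only [hQ, Finset.prod_range_succ, div_eq_mul_inv]
  have hQm : 1 - Q m ≠ 0 := by
    intro h
    have : Q m = 1 := (sub_eq_zero.1 h).symm
    simp only [hQ, Finset.prod_inv_distrib] at this
    exact hmul1 (inv_eq_one.1 this)
  -- The starting value that makes the affine recursion for `ρ` periodic; it exists because `Q m`,
  -- the inverse of the multiplier, is not one.
  set s : ℂ := B m / (1 - Q m) with hs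
  set ρ : ℕ → ℂ := fun k => s * Q k + B k with hρ
  have hρs : ∀ k, ρ (k + 1) = ρ k / δ k - τ k := fun k => by
    simp only [hρ, hQs, hBs]; ring
  have hρm : ρ m = ρ 0 := by
    have h1 : s * (1 - Q m) = B m := div_mul_cancel₀ _ hQm
    have h2 : Q 0 = 1 := by simp [hQ]
    have h3 : B 0 = 0 := rfl
    simp only [hρ, h2, h3]
    linear_combination -h1
  have hlog : logDeriv (fun b => ∏ k ∈ Finset.range m, (d * orbit d k (b, α b) ^ (d - 1))) c =
      ∑ k ∈ Finset.range m, (d - 1) * D k / z k := by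
    have hfac : ∀ k, HasDerivAt (fun b => d * orbit d k (b, α b) ^ (d - 1))
        (d * (((d - 1 : ℕ) : ℂ) * z k ^ (d - 1 - 1) * D k)) c := fun k =>
      ((hDer k).pow (d - 1)).const_mul (d : ℂ)
    rw [logDeriv_prod (f := fun k b => d * orbit d k (b, α b) ^ (d - 1))
      (fun k hk => hδ0 k (Finset.mem_range.1 hk)) (fun k _ => (hfac k).differentiableAt)]
    refine Finset.sum_congr rfl fun k hk => ?_
    rw [logDeriv_apply, (hfac k).deriv]
    have hz0' := hz0 k (Finset.mem_range.1 hk)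
    have e : z k ^ (d - 1) = z k ^ (d - 1 - 1) * z k := by rw [← pow_succ]; congr 1; omega
    have hp := pow_ne_zero (d - 1 - 1) hz0'
    change d * (((d - 1 : ℕ) : ℂ) * z k ^ (d - 1 - 1) * D k) / (d * z k ^ (d - 1)) = _
    rw [e, Nat.cast_sub (by omega), Nat.cast_one]
    field_simp
  have hsum : ∑ k ∈ Finset.range m, ρ k = 0 := by
    rw [logDeriv_apply, h0, zero_div] at hlog
    rw [← sum_range_shift hρm]
    -- Around the cycle the differences cancel, so $\sum\rho_k$ is the logarithmic derivative of the
    -- multiplier.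
    have h1 : ∀ k ∈ Finset.range m,
        (d - 1) * D k / z k = (ρ k * D k - ρ (k + 1) * D (k + 1)) + ρ (k + 1) := by
      intro k hk
      have hz0' := hz0 k (Finset.mem_range.1 hk)
      have hδ0' := hδ0 k (Finset.mem_range.1 hk)
      have h2 : ((d : ℂ) - 1) / z k = δ k * τ k := by
        have e : z k ^ d = z k ^ (d - 1) * z k := by rw [← pow_succ]; congr 1; omega
        have hp := pow_ne_zero (d - 1) hz0'
        simp only [hδ, hτ, e]
        field_simp
      have h3 : δ k * τ k = ρ k - δ k * ρ (k + 1) := by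
        rw [hρs]; field_simp; ring
      rw [mul_div_right_comm, h2, h3, hDs]
      ring
    rw [Finset.sum_congr rfl h1, Finset.sum_add_distrib,
      Finset.sum_range_sub' (fun k => ρ k * D k), hρm, hDm, sub_self, zero_add] at hlog
    exact hlog.symm
  have := (pole_coeff_eq_zero_of_cycle (A := 1) hd h.1 (fun k => orbit_succ d k (c, α c)) h.2.1
    h.orbit_injOn hmul (ρ := ρ) (fun k => by rw [one_mul]; exact hρs k) hρm hsum).1
  exact one_ne_zero this

/-! ### Implicit functions and local graphs. -/

theorem hasDerivAt_slice_fst {P : ℂ × ℂ → ℂ} {p : ℂ × ℂ} (hP : DifferentiableAt ℂ P p) :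
    HasDerivAt (fun b => P (b, p.2)) (fderiv ℂ P p (1, 0)) p.1 :=
  hP.hasFDerivAt.comp_hasDerivAt p.1 ((hasDerivAt_id p.1).prodMk (hasDerivAt_const p.1 p.2))

theorem hasDerivAt_slice_snd {P : ℂ × ℂ → ℂ} {p : ℂ × ℂ} (hP : DifferentiableAt ℂ P p) :
    HasDerivAt (fun y => P (p.1, y)) (fderiv ℂ P p (0, 1)) p.2 :=
  hP.hasFDerivAt.comp_hasDerivAt p.2 ((hasDerivAt_const p.2 p.1).prodMk (hasDerivAt_id p.2))

/-- Implicit function theorem for analytic functions of two complex variables, solved for the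
second variable. -/
theorem exists_analyticAt_snd_eq {P : ℂ × ℂ → ℂ} {p : ℂ × ℂ} (hP : AnalyticAt ℂ P p) (h0 : P p = 0)
    (h2 : fderiv ℂ P p (0, 1) ≠ 0) :
    ∃ ζ : ℂ → ℂ, AnalyticAt ℂ ζ p.1 ∧ ζ p.1 = p.2 ∧ ∀ᶠ q in 𝓝 p, (P q = 0 ↔ q.2 = ζ q.1) := by
  have cdf : ContDiffAt ℂ ⊤ P p := hP.contDiffAt
  have hinv : (fderiv ℂ P p ∘L .inr ℂ ℂ ℂ).IsInvertible := by
    refine ⟨ContinuousLinearEquiv.unitsEquivAut ℂ (Units.mk0 _ h2), ?_⟩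
    ext
    simp
  refine ⟨cdf.implicitFunction (by simp) hinv, ?_, cdf.implicitFunction_apply_self _ hinv, ?_⟩
  · exact (cdf.contDiffAt_implicitFunction (by simp) hinv).analyticAt
  · filter_upwards [cdf.eventually_apply_eq_iff_implicitFunction (by simp) hinv] with q hq
    rw [← h0, hq, eq_comm]

/-- Implicit function theorem for analytic functions of two complex variables, solved for the
first variable. -/
theorem exists_analyticAt_fst_eq {P : ℂ × ℂ → ℂ} {p : ℂ × ℂ} (hP : AnalyticAt ℂ P p) (h0 : P p = 0)
    (h1 : fderiv ℂ P p (1, 0) ≠ 0) :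
    ∃ γ : ℂ → ℂ, AnalyticAt ℂ γ p.2 ∧ γ p.2 = p.1 ∧ ∀ᶠ q in 𝓝 p, (P q = 0 ↔ q.1 = γ q.2) := by
  have hP' : AnalyticAt ℂ (fun q : ℂ × ℂ => P q.swap) p.swap :=
    AnalyticAt.fun_comp (g := P) (by simpa using hP) (analyticAt_snd.prod analyticAt_fst)
  have hder : fderiv ℂ (fun q : ℂ × ℂ => P q.swap) p.swap (0, 1) = fderiv ℂ P p (1, 0) :=
    (hasDerivAt_slice_snd hP'.differentiableAt).unique (hasDerivAt_slice_fst hP.differentiableAt)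
  obtain ⟨γ, hγ, hγp, hiff⟩ := exists_analyticAt_snd_eq hP' (by simpa using h0) (by rwa [hder])
  refine ⟨γ, hγ, hγp, ?_⟩
  have ht : Tendsto (Prod.swap : ℂ × ℂ → ℂ × ℂ) (𝓝 p) (𝓝 p.swap) := continuous_swap.tendsto p
  filter_upwards [ht.eventually hiff] with q hq
  simpa using hq

theorem eventually_mem_closure_imp {X : Set (ℂ × ℂ)} {P : ℂ × ℂ → ℂ} {p : ℂ × ℂ}
    (hP : Continuous P) (hX : ∀ᶠ q in 𝓝 p, q ∈ X → P q = 0) :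
    ∀ᶠ q in 𝓝 p, q ∈ closure X → P q = 0 := by
  filter_upwards [eventually_eventually_nhds.2 hX] with q hq hqX
  have h1 : ∃ᶠ x in 𝓝 q, x ∈ {x | P x = 0} :=
    (mem_closure_iff_frequently.1 hqX).mp (hq.mono fun x hx => hx)
  have h2 := mem_closure_iff_frequently.2 h1
  rwa [(isClosed_eq hP continuous_const).closure_eq] at h2

/-- Local structure of the closure of a set `X` which, away from `p` and from the critical points
of the second projection, is the zero set of an analytic function with nonzero derivative in the
first variable. -/
theorem exists_graph_of_vertical_tangent {X : Set (ℂ × ℂ)} {P : ℂ × ℂ → ℂ} {p : ℂ × ℂ}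
    (hP : ∀ q, AnalyticAt ℂ P q) (h0 : P p = 0) (h2 : fderiv ℂ P p (0, 1) = 0)
    (h1 : fderiv ℂ P p (1, 0) ≠ 0) (hX : ∀ᶠ q in 𝓝 p, q ∈ X → P q = 0)
    (hX' : ∀ᶠ q in 𝓝 p, q ≠ p → P q = 0 → fderiv ℂ P q (0, 1) ≠ 0 → q ∈ X)
    (hnc : ¬ ∀ᶠ y in 𝓝 p.2, P (p.1, y) = 0) :
    p ∈ closure X ∧ (∀ᶠ q in 𝓝 p, q ∈ closure X → q ≠ p → q ∈ X) ∧
    ∃ γ : ℂ → ℂ, AnalyticAt ℂ γ p.2 ∧ γ p.2 = p.1 ∧ deriv γ p.2 = 0 ∧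
      ∀ᶠ q in 𝓝 p, (q ∈ closure X ↔ q.1 = γ q.2) := by
  obtain ⟨γ, hγ, hγp, hiff⟩ := exists_analyticAt_fst_eq (hP p) h0 h1
  have ht : Tendsto (fun y => (γ y, y)) (𝓝 p.2) (𝓝 p) := by
    have := hγ.continuousAt.tendsto.prodMk_nhds (tendsto_id (x := 𝓝 p.2))
    rwa [hγp] at this
  have hzero : ∀ᶠ y in 𝓝 p.2, P (γ y, y) = 0 := by
    filter_upwards [ht.eventually hiff] with y hy
    exact hy.2 rfl
  have hrel : ∀ᶠ y in 𝓝 p.2,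
      deriv γ y * fderiv ℂ P (γ y, y) (1, 0) + fderiv ℂ P (γ y, y) (0, 1) = 0 := by
    filter_upwards [eventually_eventually_nhds.2 hzero, hγ.eventually_analyticAt] with y hy hγy
    have hc : HasDerivAt (fun y => P (γ y, y)) (fderiv ℂ P (γ y, y) (deriv γ y, 1)) y :=
      HasFDerivAt.comp_hasDerivAt (f := fun y => (γ y, y)) y
        (hP (γ y, y)).differentiableAt.hasFDerivAt
        (hγy.differentiableAt.hasDerivAt.prodMk (hasDerivAt_id y))
    have hc0 : HasDerivAt (fun y => P (γ y, y)) 0 y :=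
      (hasDerivAt_const y (0 : ℂ)).congr_of_eventuallyEq hy
    rw [← smul_eq_mul, ← map_smul, ← map_add]
    simpa using hc.unique hc0
  have hγ'p : deriv γ p.2 = 0 := by
    have := hrel.self_of_nhds
    rw [hγp, Prod.mk.eta, h2, add_zero] at this
    exact (mul_eq_zero.1 this).resolve_right h1
  -- Otherwise `γ` would be constant and `P` would vanish on a vertical segment. Where
  -- $\gamma'\ne0$, `hrel` gives $\partial P/\partial z\ne0$, so the graph minus `p` lies in `X`.
  have hγ' : ∀ᶠ y in 𝓝[≠] p.2, deriv γ y ≠ 0 := by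
    refine hγ.deriv.eventually_eq_zero_or_eventually_ne_zero.resolve_left fun hcon => hnc ?_
    have hconst : ∀ᶠ y in 𝓝 p.2, γ y = γ p.2 := by
      obtain ⟨s, hs, hball⟩ := Metric.eventually_nhds_iff_ball.1
        (hcon.and hγ.eventually_analyticAt)
      refine Filter.eventually_of_mem (Metric.ball_mem_nhds _ hs) fun y hy => ?_
      exact Metric.isOpen_ball.is_const_of_deriv_eq_zero
        (convex_ball p.2 s).isPreconnected
        (fun x hx => (hball x hx).2.differentiableAt.differentiableWithinAt)
        (fun x hx => (hball x hx).1) hy (Metric.mem_ball_self hs)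
    filter_upwards [hconst, hzero] with y hy1 hy2
    rwa [hy1, hγp] at hy2
  have hmem : ∀ᶠ y in 𝓝[≠] p.2, (γ y, y) ∈ X := by
    filter_upwards [hγ', nhdsWithin_le_nhds hrel, nhdsWithin_le_nhds hzero,
      nhdsWithin_le_nhds (ht.eventually hX'), self_mem_nhdsWithin,
      nhdsWithin_le_nhds (ht.eventually
        ((hP p).fderiv.continuousAt.clm_apply continuousAt_const |>.eventually_ne h1))]
      with y hy1 hy2 hy3 hy4 hy5 hy6
    refine hy4 (fun h => hy5 (congrArg Prod.snd h)) hy3 fun h => ?_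
    rw [h, add_zero] at hy2
    exact (mul_ne_zero hy1 hy6) hy2
  have hcl : p ∈ closure X :=
    mem_closure_of_tendsto (ht.mono_left nhdsWithin_le_nhds) hmem
  have hPc : Continuous P := continuous_iff_continuousAt.2 fun q => (hP q).continuousAt
  have hgr : ∀ᶠ q in 𝓝 p, q.1 = γ q.2 → q ≠ p → q ∈ X := by
    have h := continuous_snd.continuousAt.tendsto.eventually (eventually_nhdsWithin_iff.1 hmem)
    filter_upwards [h] with q hq hq1 hqp
    have h3 : q.2 ≠ p.2 := fun h3 => hqp (Prod.ext (by rw [hq1, h3, hγp]) h3)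
    have := hq h3
    rwa [← hq1] at this
  refine ⟨hcl, ?_, γ, hγ, hγp, hγ'p, ?_⟩
  · filter_upwards [hgr, hiff, eventually_mem_closure_imp hPc hX] with q hq1 hq2 hq3 hq4
    exact hq1 (hq2.1 (hq3 hq4))
  · filter_upwards [hgr, hiff, eventually_mem_closure_imp hPc hX] with q hq1 hq2 hq3
    refine ⟨fun h => hq2.1 (hq3 h), fun h => ?_⟩
    by_cases hqp : q = p
    · rwa [hqp]
    · exact subset_closure (hq1 h hqp)

/-- Local structure of a set that is near `p` the zero set of an analytic function with nonzero
derivative in the second variable. -/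
theorem exists_graph_of_transverse {X : Set (ℂ × ℂ)} {P : ℂ × ℂ → ℂ} {p : ℂ × ℂ}
    (hP : ∀ q, AnalyticAt ℂ P q) (h0 : P p = 0) (h2 : fderiv ℂ P p (0, 1) ≠ 0)
    (hX : ∀ᶠ q in 𝓝 p, (q ∈ X ↔ P q = 0)) :
    (∀ᶠ q in 𝓝 p, q ∈ closure X → q ∈ X) ∧
    ∃ ζ : ℂ → ℂ, AnalyticAt ℂ ζ p.1 ∧ ζ p.1 = p.2 ∧
      ∀ᶠ q in 𝓝 p, (q ∈ closure X ↔ q.2 = ζ q.1) := by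
  obtain ⟨ζ, hζ, hζp, hiff⟩ := exists_analyticAt_snd_eq (hP p) h0 h2
  have hPc : Continuous P := continuous_iff_continuousAt.2 fun q => (hP q).continuousAt
  have hcl := eventually_mem_closure_imp hPc (hX.mono fun q hq => hq.1)
  refine ⟨?_, ζ, hζ, hζp, ?_⟩
  · filter_upwards [hcl, hX] with q h1 h2 h3
    exact h2.2 (h1 h3)
  · filter_upwards [hcl, hX, hiff] with q h1 h2 h3
    exact ⟨fun h => h3.1 (h1 h), fun h => subset_closure (h2.2 (h3.2 h))⟩

/-! ### The quotient of $f_c^{\circ mv}(z)-z$ by $f_c^{\circ m}(z)-z$. -/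

/-- The factor by which the `k`-th iterate of `f_c` stretches the difference `a - b`. -/
def stretch (d k : ℕ) (t : ℂ × ℂ × ℂ) : ℂ :=
  ∏ j ∈ Finset.range k, ∑ i ∈ Finset.range d,
    orbit d j (t.1, t.2.1) ^ i * orbit d j (t.1, t.2.2) ^ (d - 1 - i)

theorem orbit_sub_orbit (d k : ℕ) (c a b : ℂ) :
    orbit d k (c, a) - orbit d k (c, b) = (a - b) * stretch d k (c, a, b) := by
  induction k with
  | zero => simp [orbit_zero, stretch]
  | succ k ih =>
    rw [orbit_succ, orbit_succ, add_sub_add_right_eq_sub, pow_sub_pow_eq_mul_geom_sum, ih,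
      stretch, stretch, Finset.prod_range_succ, mul_assoc]

theorem stretch_self (d k : ℕ) (c a : ℂ) :
    stretch d k (c, a, a) = ∏ j ∈ Finset.range k, (d * orbit d j (c, a) ^ (d - 1)) :=
  Finset.prod_congr rfl fun j _ => geom_sum_self d (orbit d j (c, a))

theorem analyticAt_stretch (d k : ℕ) (t : ℂ × ℂ × ℂ) : AnalyticAt ℂ (stretch d k) t := by
  unfold stretch
  refine Finset.analyticAt_fun_prod _ fun j _ => Finset.analyticAt_fun_sum _ fun i _ => ?_
  have h1 : AnalyticAt ℂ (fun t : ℂ × ℂ × ℂ => orbit d j (t.1, t.2.1)) t :=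
    AnalyticAt.fun_comp (analyticAt_orbit d j _)
      (analyticAt_fst.prod (AnalyticAt.fun_comp analyticAt_fst analyticAt_snd))
  have h2 : AnalyticAt ℂ (fun t : ℂ × ℂ × ℂ => orbit d j (t.1, t.2.2)) t :=
    AnalyticAt.fun_comp (analyticAt_orbit d j _)
      (analyticAt_fst.prod (AnalyticAt.fun_comp analyticAt_snd analyticAt_snd))
  exact (h1.pow i).mul (h2.pow _)

/-- The quotient of `f_c^{m v}(x) - x` by `f_c^m(x) - x`. -/
def orbitQuot (d m v : ℕ) (p : ℂ × ℂ) : ℂ :=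
  ∑ k ∈ Finset.range v, stretch d (m * k) (p.1, orbit d m p, p.2)

/-- Telescoping over multiples of `m`. No division occurs in `orbitQuot`, so it is analytic also
where the divisor vanishes. -/
theorem orbit_mul_sub (d m v : ℕ) (p : ℂ × ℂ) :
    orbit d (m * v) p - p.2 = (orbit d m p - p.2) * orbitQuot d m v p := by
  induction v with
  | zero => simp [orbitQuot, orbit_zero]
  | succ v ih =>
    have h := orbit_sub_orbit d (m * v) p.1 (orbit d m p) p.2
    rw [← orbit_add] at h
    rw [Nat.mul_succ, orbitQuot, Finset.sum_range_succ, mul_add, ← h, ← orbitQuot, ← ih]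
    simp

theorem analyticAt_orbitQuot (d m v : ℕ) (p : ℂ × ℂ) : AnalyticAt ℂ (orbitQuot d m v) p := by
  unfold orbitQuot
  refine Finset.analyticAt_fun_sum _ fun k _ => ?_
  exact AnalyticAt.fun_comp (analyticAt_stretch d (m * k) _)
    (analyticAt_fst.prod ((analyticAt_orbit d m p).prod analyticAt_snd))

theorem continuous_orbitQuot (d m v : ℕ) : Continuous (orbitQuot d m v) :=
  continuous_iff_continuousAt.2 fun p => (analyticAt_orbitQuot d m v p).continuousAt

theorem orbit_mul_eq {d m : ℕ} {p : ℂ × ℂ} (h : orbit d m p = p.2) (k : ℕ) :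
    orbit d (m * k) p = p.2 := by
  have := orbit_mul_sub d m k p
  rw [h, sub_self, zero_mul, sub_eq_zero] at this
  exact this

theorem multiplier_mul {d m : ℕ} {p : ℂ × ℂ} (h : orbit d m p = p.2) (k : ℕ) :
    multiplier (unicritical d p.1) (m * k) p.2 = multiplier (unicritical d p.1) m p.2 ^ k := by
  simp only [multiplier_eq_prod]
  induction k with
  | zero => simp
  | succ k ih =>
    rw [Nat.mul_succ, Finset.prod_range_add, ih, pow_succ]
    congr 1
    refine Finset.prod_congr rfl fun j _ => ?_
    rw [add_comm, orbit_add, Prod.mk.eta, orbit_mul_eq h]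

/-- This is where roots of unity enter: a zero of the geometric sum is a `v`-th root of unity. -/
theorem orbitQuot_of_fixed {d m : ℕ} {p : ℂ × ℂ} (h : orbit d m p = p.2) (v : ℕ) :
    orbitQuot d m v p =
      ∑ k ∈ Finset.range v, multiplier (unicritical d p.1) m p.2 ^ k := by
  refine Finset.sum_congr rfl fun k _ => ?_
  rw [h, stretch_self, ← multiplier_mul h, multiplier_eq_prod]

theorem analyticAt_orbit_sub_snd (d n : ℕ) (q : ℂ × ℂ) :
    AnalyticAt ℂ (fun q : ℂ × ℂ => orbit d n q - q.2) q :=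
  (analyticAt_orbit d n q).sub analyticAt_snd

theorem fderiv_orbit_sub_snd (d n : ℕ) (q : ℂ × ℂ) :
    fderiv ℂ (fun q : ℂ × ℂ => orbit d n q - q.2) q (0, 1) =
      multiplier (unicritical d q.1) n q.2 - 1 := by
  rw [multiplier_eq_prod]
  exact (hasDerivAt_slice_snd (analyticAt_orbit_sub_snd d n q).differentiableAt).unique
    ((hasDerivAt_orbit d n q.1 q.2).sub (hasDerivAt_id q.2))

/-- Product rule for `orbit_mul_sub`. At a zero of the quotient it reduces "multiplier different
from one" to a nonzero derivative of the quotient. -/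
theorem fderiv_orbit_sub_snd_eq_mul (d m v : ℕ) (q : ℂ × ℂ) :
    multiplier (unicritical d q.1) (m * v) q.2 - 1 =
      (multiplier (unicritical d q.1) m q.2 - 1) * orbitQuot d m v q +
        (orbit d m q - q.2) * fderiv ℂ (orbitQuot d m v) q (0, 1) := by
  rw [← fderiv_orbit_sub_snd, ← fderiv_orbit_sub_snd]
  have h1 := hasDerivAt_slice_snd (analyticAt_orbit_sub_snd d (m * v) q).differentiableAt
  have h2 := hasDerivAt_slice_snd (analyticAt_orbit_sub_snd d m q).differentiableAt
  have h3 := hasDerivAt_slice_snd (analyticAt_orbitQuot d m v q).differentiableAt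
  have h4 := h2.fun_mul h3
  simp only [Prod.mk.eta] at h4
  refine h1.unique (h4.congr_of_eventuallyEq (Eventually.of_forall fun y => ?_))
  exact orbit_mul_sub d m v (q.1, y)

theorem norm_lt_norm_orbit {d : ℕ} (hd : 2 ≤ d) {c y : ℂ} (hy : 3 + ‖c‖ ≤ ‖y‖) {n : ℕ}
    (hn : 0 < n) : ‖y‖ < ‖orbit d n (c, y)‖ := by
  have hstep : ∀ x : ℂ, ‖y‖ ≤ ‖x‖ → ‖y‖ < ‖x ^ d + c‖ := by
    intro x hx
    have hc0 := norm_nonneg c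
    have h1 : ‖x‖ ^ 2 ≤ ‖x‖ ^ d := pow_le_pow_right₀ (by linarith) hd
    have h2 : ‖x‖ ^ d ≤ ‖x ^ d + c‖ + ‖c‖ := by
      rw [← norm_pow]
      have := norm_sub_le (x ^ d + c) c
      simpa using this
    nlinarith
  induction n with
  | zero => omega
  | succ n ih =>
    rw [orbit_succ]
    refine hstep _ ?_
    rcases Nat.eq_zero_or_pos n with rfl | h
    · exact le_rfl
    · exact (ih h).le

/-- By the identity theorem the iterate would be the identity on the whole plane, but points of
large modulus strictly grow. -/
theorem not_eventually_orbit_eq {d n : ℕ} (hd : 2 ≤ d) (hn : 0 < n) (c y₀ : ℂ) :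
    ¬ ∀ᶠ y in 𝓝 y₀, orbit d n (c, y) = y := by
  intro h
  have han : AnalyticOnNhd ℂ (fun y => orbit d n (c, y)) Set.univ := fun y _ =>
    AnalyticAt.fun_comp (analyticAt_orbit d n _) (analyticAt_const.prod analyticAt_id)
  have heq := han.eqOn_of_preconnected_of_eventuallyEq (fun y _ => analyticAt_id)
    isPreconnected_univ (Set.mem_univ y₀) h
  have hy : ‖((3 + ‖c‖ : ℝ) : ℂ)‖ = 3 + ‖c‖ := by
    rw [Complex.norm_real, Real.norm_of_nonneg (by positivity)]
  have h1 := norm_lt_norm_orbit hd hy.ge hn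
  have h2 : orbit d n (c, ((3 + ‖c‖ : ℝ) : ℂ)) = ((3 + ‖c‖ : ℝ) : ℂ) := heq (Set.mem_univ _)
  rw [h2] at h1
  exact lt_irrefl _ h1

/-- At a point of an `m`-cycle whose multiplier is a root of unity other than one, the quotient of
`f_c^{m v}(x) - x` by `f_c^m(x) - x` vanishes to order two in the variable `x`. -/
theorem fderiv_orbitQuot_snd_eq_zero {d m v : ℕ} {p : ℂ × ℂ} (h : orbit d m p = p.2)
    (hmul1 : multiplier (unicritical d p.1) m p.2 ≠ 1)
    (hmul0 : multiplier (unicritical d p.1) m p.2 ≠ 0) (hP0 : orbitQuot d m v p = 0) :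
    fderiv ℂ (orbitQuot d m v) p (0, 1) = 0 := by
  obtain ⟨c, x⟩ := p
  simp only at h hmul1 hmul0 hP0
  set l := multiplier (unicritical d c) m x with hl
  set P : ℂ → ℂ := fun y => orbitQuot d m v (c, y) with hP
  set P' := fderiv ℂ (orbitQuot d m v) (c, x) (0, 1) with hP'
  have hPd : HasDerivAt P P' x :=
    hasDerivAt_slice_snd (analyticAt_orbitQuot d m v (c, x)).differentiableAt
  set H : ℂ → ℂ := fun y => orbit d m (c, y) with hH
  set G : ℂ → ℂ := fun y => orbit d (m * v) (c, y) with hG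
  have hHx : H x = x := h
  have hGx : G x = x := orbit_mul_eq h v
  have hHd : HasDerivAt H l x := by
    rw [hl, multiplier_eq_prod]; exact hasDerivAt_orbit d m c x
  have hGd : DifferentiableAt ℂ G x := (hasDerivAt_orbit d (m * v) c x).differentiableAt
  set T₁ : ℂ → ℂ := fun y => stretch d m (c, H y, y) with hT₁
  set T₂ : ℂ → ℂ := fun y => stretch d m (c, G y, y) with hT₂
  have hT₁d : DifferentiableAt ℂ T₁ x :=
    (analyticAt_stretch d m _).differentiableAt.fun_comp' x
      ((differentiableAt_const c).prodMk (hHd.differentiableAt.prodMk differentiableAt_id))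
  have hT₂d : DifferentiableAt ℂ T₂ x :=
    (analyticAt_stretch d m _).differentiableAt.fun_comp' x
      ((differentiableAt_const c).prodMk (hGd.prodMk differentiableAt_id))
  have hT₁x : T₁ x = l := by
    simp only [hT₁, hHx, stretch_self, hl, multiplier_eq_prod]
  have hT₂x : T₂ x = l := by
    simp only [hT₂, hGx, stretch_self, hl, multiplier_eq_prod]
  have hPx : P x = 0 := hP0
  have hne : ∀ᶠ y in 𝓝[≠] x, H y - y ≠ 0 := by
    have := (hHd.fun_sub (hasDerivAt_id' x)).eventually_ne (c := 0) (sub_ne_zero.2 hmul1)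
    simpa using this
  -- Since `G` and `H` commute, $G-\mathrm{id}$ at $H(y)$ can be computed in two ways.
  -- Differentiation at the zero `x` of `P` gives $l^2P'=lP'$.
  have heq : (fun y => T₁ y * P (H y)) =ᶠ[𝓝 x] fun y => T₂ y * P y := by
    filter_upwards [eventually_nhdsWithin_iff.1 hne] with y hy
    rcases eq_or_ne y x with rfl | hyx
    · simp [hHx, hPx]
    replace hy := hy hyx
    have e1 : H (H y) - H y = (H y - y) * T₁ y := orbit_sub_orbit d m c (H y) y
    have e2 : H (G y) - H y = (G y - y) * T₂ y := orbit_sub_orbit d m c (G y) y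
    have e3 : G y - y = (H y - y) * P y := orbit_mul_sub d m v (c, y)
    have e4 : G (H y) - H y = (H (H y) - H y) * P (H y) := orbit_mul_sub d m v (c, H y)
    have e5 : G (H y) = H (G y) := by
      have := orbit_add d (m * v) m (c, y)
      rw [add_comm, orbit_add] at this
      exact this.symm
    apply mul_left_cancel₀ hy
    calc (H y - y) * (T₁ y * P (H y)) = (H (H y) - H y) * P (H y) := by rw [e1]; ring
      _ = (G y - y) * T₂ y := by rw [← e4, e5, e2]
      _ = _ := by rw [e3]; ring
  have hPH : HasDerivAt (fun y => P (H y)) (P' * l) x := by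
    refine HasDerivAt.comp (h₂ := P) x ?_ hHd
    rwa [hHx]
  have hL := hT₁d.hasDerivAt.fun_mul hPH
  have hR := hT₂d.hasDerivAt.fun_mul hPd
  have := hL.unique (hR.congr_of_eventuallyEq heq)
  simp only [hHx, hPx, hT₁x, hT₂x, mul_zero, zero_add] at this
  have h3 : l * P' * (l - 1) = 0 := by linear_combination this
  have h4 := (mul_eq_zero.1 h3).resolve_right (sub_ne_zero.2 hmul1)
  exact (mul_eq_zero.1 h4).resolve_left hmul0

theorem orbitQuot_eq_zero_of_isPrimitiveRoot {d m v : ℕ} {p : ℂ × ℂ} (h : orbit d m p = p.2)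
    (hv : IsPrimitiveRoot (multiplier (unicritical d p.1) m p.2) v) (hv2 : 2 ≤ v) :
    orbitQuot d m v p = 0 := by
  rw [orbitQuot_of_fixed h, hv.geom_sum_eq_zero hv2]

/-- At a satellite point the quotient has nonzero derivative in the parameter, and nearby it does
not vanish on the curve of `m`-periodic points. -/
theorem fderiv_orbitQuot_fst_ne_zero {d m v : ℕ} (hd : 2 ≤ d) {p : ℂ × ℂ}
    (h : HasPeriod (unicritical d p.1) m p.2)
    (hv : IsPrimitiveRoot (multiplier (unicritical d p.1) m p.2) v) (hv2 : 2 ≤ v) :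
    fderiv ℂ (orbitQuot d m v) p (1, 0) ≠ 0 ∧
      ∀ᶠ q in 𝓝 p, q ≠ p → orbitQuot d m v q = 0 → orbit d m q - q.2 ≠ 0 := by
  have hfix : orbit d m p = p.2 := h.2.1
  have hl1 : multiplier (unicritical d p.1) m p.2 ≠ 1 := hv.ne_one hv2
  have hl0 : multiplier (unicritical d p.1) m p.2 ≠ 0 := hv.ne_zero (by omega)
  have hP0 := orbitQuot_eq_zero_of_isPrimitiveRoot hfix hv hv2
  have hP2 := fderiv_orbitQuot_snd_eq_zero hfix hl1 hl0 hP0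
  obtain ⟨α, hα, hαp, hiff⟩ := exists_analyticAt_snd_eq (analyticAt_orbit_sub_snd d m p)
    (sub_eq_zero.2 hfix) (by rw [fderiv_orbit_sub_snd]; exact sub_ne_zero.2 hl1)
  obtain ⟨c, x⟩ := p
  simp only at hα hαp h hfix hl1 hl0 hv
  subst hαp
  have hαd := hα.differentiableAt.hasDerivAt
  have ht : Tendsto (fun b => (b, α b)) (𝓝 c) (𝓝 (c, α c)) :=
    tendsto_id.prodMk_nhds hα.continuousAt.tendsto
  have hper : ∀ᶠ b in 𝓝 c, orbit d m (b, α b) = α b := by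
    filter_upwards [ht.eventually hiff] with b hb
    exact sub_eq_zero.1 (hb.2 rfl)
  set L : ℂ → ℂ := fun b => ∏ k ∈ Finset.range m, (d * orbit d k (b, α b) ^ (d - 1)) with hL
  have hLc : L c = multiplier (unicritical d c) m (α c) := (multiplier_eq_prod d m c (α c)).symm
  have hL' : deriv L c ≠ 0 :=
    deriv_multiplier_ne_zero hd h hαd hper (hv.norm'_eq_one (by omega)) hl1
  have hLd : HasDerivAt L (deriv L c) c := (differentiableAt_of_deriv_ne_zero hL').hasDerivAt
  set u : ℂ → ℂ := fun b => orbitQuot d m v (b, α b) with hu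
  have hud : HasDerivAt u (fderiv ℂ (orbitQuot d m v) (c, α c) (1, 0)) c := by
    have h1 : HasDerivAt u (fderiv ℂ (orbitQuot d m v) (c, α c) (1, deriv α c)) c :=
      HasFDerivAt.comp_hasDerivAt (f := fun b => (b, α b)) c
        (analyticAt_orbitQuot d m v (c, α c)).differentiableAt.hasFDerivAt
        ((hasDerivAt_id c).prodMk hαd)
    refine h1.congr_deriv ?_
    have e : ((1 : ℂ), deriv α c) = (1, 0) + deriv α c • ((0 : ℂ), (1 : ℂ)) := by simp
    rw [e, map_add, map_smul, hP2, smul_zero, add_zero]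
  -- Differentiated at `c`, this reads $u'(c)(L(c)-1)=vL(c)^{v-1}L'(c)\ne0$, and `u'` is the
  -- parameter derivative of the quotient since `hP2` kills the other one.
  have hrel : (fun b => u b * (L b - 1)) =ᶠ[𝓝 c] fun b => L b ^ v - 1 := by
    filter_upwards [hper] with b hb
    have : u b = ∑ k ∈ Finset.range v, L b ^ k := by
      simp only [hu, hL]
      rw [orbitQuot_of_fixed hb, multiplier_eq_prod]
    rw [this, geom_sum_mul]
  have huc : u c = 0 := hP0
  have hu' : fderiv ℂ (orbitQuot d m v) (c, α c) (1, 0) ≠ 0 := by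
    intro h0
    rw [h0] at hud
    have h1 := hud.fun_mul (hLd.sub_const 1)
    have h2 := (hLd.fun_pow v).sub_const 1
    have h3 := h1.unique (h2.congr_of_eventuallyEq hrel)
    rw [huc, zero_mul, zero_mul, add_zero] at h3
    refine mul_ne_zero (mul_ne_zero ?_ ?_) hL' h3.symm
    · exact_mod_cast (by omega : v ≠ 0)
    · rw [hLc]; exact pow_ne_zero _ hl0
  refine ⟨hu', ?_⟩
  have hune := hud.eventually_ne (c := 0) hu'
  have hfst : Tendsto (Prod.fst : ℂ × ℂ → ℂ) (𝓝 (c, α c)) (𝓝 c) := continuous_fst.tendsto _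
  have hune' := hfst.eventually (eventually_nhdsWithin_iff.1 hune)
  filter_upwards [hune', hiff] with q hq1 hq2 hqp hq0 hH
  have e := hq2.1 hH
  by_cases hqc : q.1 = c
  · exact hqp (Prod.ext hqc (by rw [e, hqc]))
  · refine hq1 hqc ?_
    simp only [hu]
    rw [← e]
    exact hq0

/-! ### Local structure of the closure of $X_n$. -/

theorem continuous_multiplier (d n : ℕ) :
    Continuous fun q : ℂ × ℂ => multiplier (unicritical d q.1) n q.2 := by
  simp_rw [multiplier_eq_prod]
  exact continuous_finsetProd _ fun j _ =>
    continuous_const.mul ((continuous_orbit d j).pow _)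

/-- At `p` only multiples of `m` are return times, and not returning is an open condition. -/
theorem HasPeriod.eventually_orbit_ne {d m : ℕ} {p : ℂ × ℂ}
    (h : HasPeriod (unicritical d p.1) m p.2) (n : ℕ) :
    ∀ᶠ q in 𝓝 p, ∀ j ∈ Finset.range n, ¬ m ∣ j → orbit d j q ≠ q.2 := by
  rw [eventually_all_finset]
  intro j _
  by_cases hj : m ∣ j
  · exact Eventually.of_forall fun q hq => absurd hj hq
  have hne : orbit d j p ≠ p.2 := by
    intro he
    have hfix : orbit d m p = p.2 := h.2.1
    rw [← Nat.mod_add_div j m, orbit_add, orbit_mul_eq hfix] at he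
    exact h.2.2 (j % m) (Nat.pos_of_ne_zero fun h0 => hj (Nat.dvd_of_mod_eq_zero h0))
      (Nat.mod_lt _ h.1) he
  have : ∀ᶠ q in 𝓝 p, orbit d j q - q.2 ≠ 0 :=
    ((continuous_orbit d j).sub continuous_snd).continuousAt.eventually_ne (sub_ne_zero.2 hne)
  exact this.mono fun q hq _ => sub_ne_zero.1 hq

theorem HasPeriod.eventually_hasPeriod {d n : ℕ} {p : ℂ × ℂ}
    (h : HasPeriod (unicritical d p.1) n p.2) :
    ∀ᶠ q in 𝓝 p, orbit d n q - q.2 = 0 → HasPeriod (unicritical d q.1) n q.2 := by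
  filter_upwards [h.eventually_orbit_ne n] with q hq hq0
  refine ⟨h.1, sub_eq_zero.1 hq0, fun j hj0 hjn => hq j (Finset.mem_range.2 hjn) fun hdvd => ?_⟩
  exact absurd (Nat.le_of_dvd hj0 hdvd) (by omega)

/-- Near one of its points, the curve `X_n` is a graph over the parameter. -/
theorem dynatomicX_graph_of_mem {d n : ℕ} {p : ℂ × ℂ} (hp : p ∈ dynatomicX d n) :
    (∀ᶠ q in 𝓝 p, q ∈ closure (dynatomicX d n) → q ∈ dynatomicX d n) ∧
    ∃ ζ : ℂ → ℂ, AnalyticAt ℂ ζ p.1 ∧ ζ p.1 = p.2 ∧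
      ∀ᶠ q in 𝓝 p, (q ∈ closure (dynatomicX d n) ↔ q.2 = ζ q.1) := by
  refine exists_graph_of_transverse (P := fun q => orbit d n q - q.2)
    (analyticAt_orbit_sub_snd d n) (sub_eq_zero.2 hp.1.2.1) ?_ ?_
  · rw [fderiv_orbit_sub_snd]
    exact sub_ne_zero.2 hp.2
  · filter_upwards [hp.1.eventually_hasPeriod,
      (continuous_multiplier d n).continuousAt.eventually_ne hp.2] with q hq1 hq2
    exact ⟨fun h => sub_eq_zero.2 h.1.2.1, fun h => ⟨hq1 h, hq2⟩⟩

/-- Near a point of period `m` whose multiplier is a primitive `v`-th root of unity, the closure of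
`X_{m v}` is a graph over the dynamical plane with a vertical tangent. -/
theorem dynatomicX_graph_of_isPrimitiveRoot {d m v : ℕ} (hd : 2 ≤ d) (hv0 : 1 ≤ v) {p : ℂ × ℂ}
    (h : HasPeriod (unicritical d p.1) m p.2)
    (hv : IsPrimitiveRoot (multiplier (unicritical d p.1) m p.2) v) :
    p ∈ closure (dynatomicX d (m * v)) ∧
    (∀ᶠ q in 𝓝 p, q ∈ closure (dynatomicX d (m * v)) → q ≠ p → q ∈ dynatomicX d (m * v)) ∧
    ∃ γ : ℂ → ℂ, AnalyticAt ℂ γ p.2 ∧ γ p.2 = p.1 ∧ deriv γ p.2 = 0 ∧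
      ∀ᶠ q in 𝓝 p, (q ∈ closure (dynatomicX d (m * v)) ↔ q.1 = γ q.2) := by
  have hfix : orbit d m p = p.2 := h.2.1
  rcases Nat.eq_or_lt_of_le hv0 with rfl | hv2
  · rw [mul_one]
    have hl : multiplier (unicritical d p.1) m p.2 = 1 := IsPrimitiveRoot.one_right_iff.1 hv
    refine exists_graph_of_vertical_tangent (P := fun q => orbit d m q - q.2)
      (analyticAt_orbit_sub_snd d m) (sub_eq_zero.2 hfix) ?_ ?_ ?_ ?_ ?_
    · rw [fderiv_orbit_sub_snd, hl, sub_self]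
    · have h1 := hasDerivAt_slice_fst (analyticAt_orbit_sub_snd d m p).differentiableAt
      rw [← h1.deriv]
      simpa using deriv_orbit_param_ne_zero hd h hl
    · exact Eventually.of_forall fun q hq => sub_eq_zero.2 hq.1.2.1
    · filter_upwards [h.eventually_hasPeriod] with q hq _ hq0 hq2
      rw [fderiv_orbit_sub_snd, sub_ne_zero] at hq2
      exact ⟨hq hq0, hq2⟩
    · simp_rw [sub_eq_zero]
      exact not_eventually_orbit_eq hd h.1 p.1 p.2
  · have hl1 : multiplier (unicritical d p.1) m p.2 ≠ 1 := hv.ne_one hv2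
    have hl0 : multiplier (unicritical d p.1) m p.2 ≠ 0 := hv.ne_zero (by omega)
    have hP0 := orbitQuot_eq_zero_of_isPrimitiveRoot hfix hv hv2
    obtain ⟨hP1, hH⟩ := fderiv_orbitQuot_fst_ne_zero hd h hv hv2
    have hmn : m < m * v := lt_mul_of_one_lt_right h.1 hv2
    have hmv : 0 < m * v := h.1.trans hmn
    refine exists_graph_of_vertical_tangent (analyticAt_orbitQuot d m v) hP0
      (fderiv_orbitQuot_snd_eq_zero hfix hl1 hl0 hP0) hP1 ?_ ?_ ?_
    · refine Eventually.of_forall fun q hq => ?_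
      have h1 := orbit_mul_sub d m v q
      rw [sub_eq_zero.2 (show orbit d (m * v) q = q.2 from hq.1.2.1)] at h1
      exact (mul_eq_zero.1 h1.symm).resolve_left (sub_ne_zero.2 (hq.1.2.2 m h.1 hmn))
    -- A nearby zero of the quotient must not return at an earlier time `m * s`; this holds because
    -- the multiplier is not an `s`-th root of unity for `0 < s < v`.
    · have hs : ∀ᶠ q in 𝓝 p, ∀ s ∈ Finset.range v, s ≠ 0 → orbitQuot d m s q ≠ 0 := by
        rw [eventually_all_finset]
        intro s hs
        by_cases hs0 : s = 0
        · exact Eventually.of_forall fun q hq => absurd hs0 hq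
        have hne : orbitQuot d m s p ≠ 0 := by
          rw [orbitQuot_of_fixed hfix]
          intro h0
          have h1 := geom_sum_mul (multiplier (unicritical d p.1) m p.2) s
          rw [h0, zero_mul] at h1
          exact hv.pow_ne_one_of_pos_of_lt hs0 (Finset.mem_range.1 hs) (sub_eq_zero.1 h1.symm)
        exact ((continuous_orbitQuot d m s).continuousAt.eventually_ne hne).mono fun q hq _ => hq
      filter_upwards [hs, hH, h.eventually_orbit_ne (m * v)] with q hq1 hq2 hq3 hqp hq0 hqd
      have hHq := hq2 hqp hq0
      refine ⟨⟨hmv, ?_, ?_⟩, ?_⟩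
      · have h1 := orbit_mul_sub d m v q
        rw [hq0, mul_zero] at h1
        exact sub_eq_zero.1 h1
      · intro j hj0 hjn
        by_cases hdvd : m ∣ j
        · obtain ⟨s, rfl⟩ := hdvd
          have h1 := orbit_mul_sub d m s q
          refine sub_ne_zero.1 (show orbit d (m * s) q - q.2 ≠ 0 from ?_)
          rw [h1]
          exact mul_ne_zero hHq (hq1 s (Finset.mem_range.2 (Nat.lt_of_mul_lt_mul_left hjn))
            (by rintro rfl; simp at hj0))
        · exact hq3 j (Finset.mem_range.2 hjn) hdvd
      · have h1 := fderiv_orbit_sub_snd_eq_mul d m v q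
        rw [hq0, mul_zero, zero_add] at h1
        rw [← sub_ne_zero, h1]
        exact mul_ne_zero hHq hqd
    · intro hev
      refine not_eventually_orbit_eq hd hmv p.1 p.2 (hev.mono fun y hy => ?_)
      have h1 := orbit_mul_sub d m v (p.1, y)
      rw [hy, mul_zero] at h1
      exact sub_eq_zero.1 h1

/-! ### The boundary: multipliers and finiteness. -/

theorem orbit_eq_of_mem_closure {d n : ℕ} {p : ℂ × ℂ} (hp : p ∈ closure (dynatomicX d n)) :
    orbit d n p = p.2 :=
  closure_minimal (t := {q : ℂ × ℂ | orbit d n q = q.2}) (fun _ hq => hq.1.2.1)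
    (isClosed_eq (continuous_orbit d n) continuous_snd) hp

/-- On `X` the point does not return at time `k`, so the factor $f_c^{\circ k}(z)-z$ can be
cancelled; vanishing of the other factor survives in the limit. -/
theorem orbitQuot_eq_zero_of_mem_closure {d k v : ℕ} (hk : 0 < k) (hv : 1 < v) {p : ℂ × ℂ}
    (hp : p ∈ closure (dynatomicX d (k * v))) : orbitQuot d k v p = 0 := by
  refine closure_minimal (t := {q : ℂ × ℂ | orbitQuot d k v q = 0}) (fun q hq => ?_)
    (isClosed_eq (continuous_orbitQuot d k v) continuous_const) hp
  have h1 := orbit_mul_sub d k v q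
  rw [sub_eq_zero.2 (show orbit d (k * v) q = q.2 from hq.1.2.1)] at h1
  exact (mul_eq_zero.1 h1.symm).resolve_left
    (sub_ne_zero.2 (hq.1.2.2 k hk (lt_mul_of_one_lt_right hk hv)))

theorem exists_hasPeriod {f : ℂ → ℂ} {n : ℕ} (hn : 0 < n) {x : ℂ} (h : f^[n] x = x) :
    ∃ m, m ∣ n ∧ HasPeriod f m x := by
  have hper : Function.IsPeriodicPt f n x := h
  refine ⟨Function.minimalPeriod f x, hper.minimalPeriod_dvd, hper.minimalPeriod_pos hn,
    Function.iterate_minimalPeriod, fun j hj0 hj => ?_⟩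
  exact Function.not_isPeriodicPt_of_pos_of_lt_minimalPeriod hj0.ne' hj

/-- A boundary point of `X_n` has a period `m` dividing `n` and its multiplier is a primitive
`n / m`-th root of unity. -/
theorem exists_isPrimitiveRoot_of_mem_curveBoundary {d n : ℕ} (hn : 1 ≤ n) {p : ℂ × ℂ}
    (hp : p ∈ curveBoundary (dynatomicX d n)) :
    ∃ m v, n = m * v ∧ HasPeriod (unicritical d p.1) m p.2 ∧
      IsPrimitiveRoot (multiplier (unicritical d p.1) m p.2) v := by
  obtain ⟨hp1, hp2⟩ := hp
  obtain ⟨m, ⟨v, rfl⟩, hm⟩ := exists_hasPeriod hn (orbit_eq_of_mem_closure hp1)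
  have hfix : orbit d m p = p.2 := hm.2.1
  refine ⟨m, v, rfl, hm, ?_⟩
  have hv0 : 0 < v := Nat.pos_of_mul_pos_left hn
  rcases Nat.eq_or_lt_of_le (show 1 ≤ v from hv0) with rfl | hv2
  · rw [IsPrimitiveRoot.one_right_iff]
    by_contra hne
    exact hp2 (by rw [mul_one]; exact ⟨hm, hne⟩)
  set l := multiplier (unicritical d p.1) m p.2 with hl
  have hlv : l ^ v = 1 := by
    have h1 := orbitQuot_eq_zero_of_mem_closure hm.1 hv2 hp1
    rw [orbitQuot_of_fixed hfix] at h1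
    have h2 := geom_sum_mul l v
    rw [h1, zero_mul] at h2
    exact sub_eq_zero.1 h2.symm
  obtain ⟨t, ht⟩ := orderOf_dvd_of_pow_eq_one hlv
  have hs0 : 0 < orderOf l := Nat.pos_of_ne_zero fun h0 => by rw [h0, zero_mul] at ht; omega
  -- If the order of `l` were a proper divisor of `v`, then $f_c^{\circ ms}$, with $s$ the order,
  -- would have multiplier one at `p`, and the quotient for `m * orderOf l` and `t` would equal `t`,
  -- not zero.
  rcases Nat.lt_or_ge 1 t with ht1 | ht1
  · exfalso
    have hp1' : p ∈ closure (dynatomicX d (m * orderOf l * t)) := by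
      rwa [mul_assoc, ← ht]
    have h1 := orbitQuot_eq_zero_of_mem_closure (Nat.mul_pos hm.1 hs0) ht1 hp1'
    rw [orbitQuot_of_fixed (orbit_mul_eq hfix _), multiplier_mul hfix, ← hl, pow_orderOf_eq_one]
      at h1
    simp at h1
    omega
  · have ht' : t = 1 := by
      rcases Nat.eq_zero_or_pos t with h0 | h0
      · rw [h0, mul_zero] at ht; omega
      · omega
    rw [ht', mul_one] at ht
    rw [ht]
    exact IsPrimitiveRoot.orderOf l

theorem mem_curveBoundary_of_isPrimitiveRoot {d m v : ℕ} (hd : 2 ≤ d) (hv0 : 1 ≤ v) {p : ℂ × ℂ}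
    (h : HasPeriod (unicritical d p.1) m p.2)
    (hv : IsPrimitiveRoot (multiplier (unicritical d p.1) m p.2) v) :
    p ∈ curveBoundary (dynatomicX d (m * v)) := by
  refine ⟨(dynatomicX_graph_of_isPrimitiveRoot hd hv0 h hv).1, fun hp => ?_⟩
  rcases Nat.eq_or_lt_of_le hv0 with rfl | hv2
  · rw [mul_one] at hp
    exact hp.2 (IsPrimitiveRoot.one_right_iff.1 hv)
  · exact hp.1.2.2 m h.1 (lt_mul_of_one_lt_right h.1 hv2) h.2.1

/-- The parameters and points of indifferent cycles are bounded. -/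
theorem norm_le_of_indifferent {d m : ℕ} (hd : 2 ≤ d) (hm : 0 < m) {p : ℂ × ℂ}
    (h : orbit d m p = p.2) (hl : ‖multiplier (unicritical d p.1) m p.2‖ = 1) : ‖p‖ ≤ 4 := by
  rw [multiplier_eq_prod, norm_prod] at hl
  obtain ⟨k, hk, hmax⟩ := Finset.exists_max_image (Finset.range m) (fun k => ‖orbit d k p‖)
    ⟨0, Finset.mem_range.2 hm⟩
  set M := ‖orbit d k p‖ with hM
  have hM0 : 0 ≤ M := norm_nonneg _
  have hle : ∀ j < m, ‖orbit d j p‖ ≤ M := fun j hj => hmax j (Finset.mem_range.2 hj)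
  have hle' : ∀ j < m, ‖orbit d (j + 1) p‖ ≤ M := by
    intro j hj
    rcases Nat.lt_or_ge (j + 1) m with h1 | h1
    · exact hle _ h1
    · rw [show j + 1 = m by omega, h, ← orbit_zero d p]
      exact hle 0 hm
  have hM1 : M ^ d ≤ M + ‖p.1‖ := by
    have h1 := hle' k (Finset.mem_range.1 hk)
    rw [orbit_succ] at h1
    have h2 := norm_sub_le (orbit d k p ^ d + p.1) p.1
    rw [add_sub_cancel_right, norm_pow] at h2
    linarith
  -- If all points had modulus at least one, the multiplier would have modulus at least $2^m$. A
  -- small point bounds `c` by $M+1$, so $M^2\le2M+1$ and $M\le3$.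
  obtain ⟨j, hj, hj1⟩ : ∃ j < m, ‖orbit d j p‖ < 1 := by
    by_contra! hcon
    have h1 : ∏ j ∈ Finset.range m, (2 : ℝ) ≤
        ∏ j ∈ Finset.range m, ‖(d * orbit d j p ^ (d - 1) : ℂ)‖ := by
      refine Finset.prod_le_prod (fun _ _ => by norm_num) fun j hj => ?_
      rw [norm_mul, norm_pow, Complex.norm_natCast]
      have h2 : (2 : ℝ) ≤ d := by exact_mod_cast hd
      have h3 := one_le_pow₀ (n := d - 1) (hcon j (Finset.mem_range.1 hj))
      nlinarith
    rw [Finset.prod_const, Finset.card_range, hl] at h1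
    have h2 : (1 : ℝ) < 2 ^ m := one_lt_pow₀ (by norm_num) hm.ne'
    linarith
  have hc : ‖p.1‖ ≤ M + 1 := by
    have h1 := hle' j hj
    have h2 := norm_sub_le (orbit d (j + 1) p) (orbit d j p ^ d)
    rw [orbit_succ, add_sub_cancel_left, norm_pow, ← orbit_succ] at h2
    have h3 : ‖orbit d j p‖ ^ d ≤ 1 := pow_le_one₀ (norm_nonneg _) hj1.le
    linarith
  have hM3 : M ≤ 3 := by
    by_contra! h3
    have h4 : M ^ 2 ≤ M ^ d := pow_le_pow_right₀ (by linarith) hd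
    nlinarith
  have hx : ‖p.2‖ ≤ M := by rw [← orbit_zero d p]; exact hle 0 hm
  exact norm_prod_le_iff.2 ⟨by linarith, by linarith⟩

/-- An infinite bounded boundary would accumulate at a point of the closure, yet the local structure
there leaves no other boundary point nearby. -/
theorem finite_curveBoundary {d n : ℕ} (hd : 2 ≤ d) (hn : 1 ≤ n) :
    (curveBoundary (dynatomicX d n)).Finite := by
  by_contra hinf
  have hsub : curveBoundary (dynatomicX d n) ⊆ Metric.closedBall 0 4 := by
    intro p hp
    obtain ⟨m, v, rfl, hm, hv⟩ := exists_isPrimitiveRoot_of_mem_curveBoundary hn hp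
    rw [mem_closedBall_zero_iff]
    exact norm_le_of_indifferent hd hm.1 hm.2.1
      (hv.norm'_eq_one (Nat.pos_of_mul_pos_left hn).ne')
  obtain ⟨p, -, hacc⟩ := Set.Infinite.exists_accPt_of_subset_isCompact hinf
    (isCompact_closedBall (0 : ℂ × ℂ) 4) hsub
  rw [accPt_iff_frequently] at hacc
  have hpcl : p ∈ closure (dynatomicX d n) := by
    rw [← closure_closure, mem_closure_iff_frequently]
    exact hacc.mono fun q hq => hq.2.1
  by_cases hpX : p ∈ dynatomicX d n
  · obtain ⟨q, hq1, hq2⟩ := (hacc.and_eventually (dynatomicX_graph_of_mem hpX).1).exists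
    exact hq1.2.2 (hq2 hq1.2.1)
  · obtain ⟨m, v, rfl, hm, hv⟩ := exists_isPrimitiveRoot_of_mem_curveBoundary hn ⟨hpcl, hpX⟩
    obtain ⟨q, hq1, hq2⟩ := (hacc.and_eventually
      (dynatomicX_graph_of_isPrimitiveRoot hd (Nat.pos_of_mul_pos_left hn) hm hv).2.1).exists
    exact hq1.2.2 (hq2 hq1.2.1 hq1.1)

theorem theorem2p1 (d n : ℕ) (hd : 2 ≤ d) (hn : 1 ≤ n) :
    IsSmoothComplexCurve (closure (dynatomicX d n)) ∧
    (curveBoundary (dynatomicX d n)).Finite ∧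
    curveBoundary (dynatomicX d n) =
      {p : ℂ × ℂ | ∃ m : ℕ, m ≤ n ∧ m ∣ n ∧ HasPeriod (unicritical d p.1) m p.2 ∧
        ∃ u v : ℕ, 1 ≤ u ∧ 1 ≤ v ∧ Nat.Coprime u v ∧ v = n / m ∧
          multiplier (unicritical d p.1) m p.2 =
            Complex.exp (2 * (Real.pi : ℂ) * Complex.I * ((u : ℂ) / (v : ℂ)))} ∧
    (∀ c₀ z₀ : ℂ, (c₀, z₀) ∈ dynatomicX d n →
      ∃ ζ : ℂ → ℂ, AnalyticAt ℂ ζ c₀ ∧ ζ c₀ = z₀ ∧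
        ∀ᶠ p : ℂ × ℂ in 𝓝 (c₀, z₀), (p ∈ closure (dynatomicX d n) ↔ p.2 = ζ p.1)) ∧
    (∀ c₀ z₀ : ℂ, (c₀, z₀) ∈ curveBoundary (dynatomicX d n) →
      ∃ γ : ℂ → ℂ, AnalyticAt ℂ γ z₀ ∧ γ z₀ = c₀ ∧ deriv γ z₀ = 0 ∧
        ∀ᶠ p : ℂ × ℂ in 𝓝 (c₀, z₀), (p ∈ closure (dynatomicX d n) ↔ p.1 = γ p.2)) := by
  have hbd : ∀ p ∈ curveBoundary (dynatomicX d n),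
      ∃ γ : ℂ → ℂ, AnalyticAt ℂ γ p.2 ∧ γ p.2 = p.1 ∧ deriv γ p.2 = 0 ∧
        ∀ᶠ q in 𝓝 p, (q ∈ closure (dynatomicX d n) ↔ q.1 = γ q.2) := by
    intro p hp
    obtain ⟨m, v, rfl, hm, hv⟩ := exists_isPrimitiveRoot_of_mem_curveBoundary hn hp
    exact (dynatomicX_graph_of_isPrimitiveRoot hd (Nat.pos_of_mul_pos_left hn) hm hv).2.2
  refine ⟨fun p hp => ?_, finite_curveBoundary hd hn, ?_,
    fun c₀ z₀ h => (dynatomicX_graph_of_mem h).2, fun c₀ z₀ h => hbd _ h⟩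
  · by_cases hpX : p ∈ dynatomicX d n
    · obtain ⟨ζ, hζ, -, hiff⟩ := (dynatomicX_graph_of_mem hpX).2
      have hF : AnalyticAt ℂ (fun q : ℂ × ℂ => q.2 - ζ q.1) p :=
        analyticAt_snd.sub (hζ.fun_comp analyticAt_fst)
      refine ⟨_, hF, fun h0 => ?_, hiff.mono fun q hq => hq.trans sub_eq_zero.symm⟩
      have h1 := hasDerivAt_slice_snd hF.differentiableAt
      rw [h0] at h1
      exact zero_ne_one (h1.unique ((hasDerivAt_id p.2).sub_const (ζ p.1)))
    · obtain ⟨γ, hγ, -, -, hiff⟩ := hbd p ⟨hp, hpX⟩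
      have hF : AnalyticAt ℂ (fun q : ℂ × ℂ => q.1 - γ q.2) p :=
        analyticAt_fst.sub (hγ.fun_comp analyticAt_snd)
      refine ⟨_, hF, fun h0 => ?_, hiff.mono fun q hq => hq.trans sub_eq_zero.symm⟩
      have h1 := hasDerivAt_slice_fst hF.differentiableAt
      rw [h0] at h1
      exact zero_ne_one (h1.unique ((hasDerivAt_id p.1).sub_const (γ p.2)))
  · ext p
    constructor
    · intro hp
      obtain ⟨m, v, rfl, hm, hv⟩ := exists_isPrimitiveRoot_of_mem_curveBoundary hn hp
      have hv0 : 0 < v := Nat.pos_of_mul_pos_left hn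
      refine ⟨m, Nat.le_mul_of_pos_right m hv0, dvd_mul_right m v, hm, ?_⟩
      obtain ⟨u, -, hcop, hu⟩ := (Complex.isPrimitiveRoot_iff _ v hv0.ne').1 hv
      -- The exponent provided may be `0` (when `v = 1`); adding `v` makes it positive without
      -- changing the root of unity.
      refine ⟨u + v, v, by omega, hv0, by simpa using hcop,
        (Nat.mul_div_cancel_left v hm.1).symm, ?_⟩
      have hvc : (v : ℂ) ≠ 0 := by exact_mod_cast hv0.ne'
      rw [← hu, Nat.cast_add, add_div, div_self hvc, mul_add, mul_one, Complex.exp_add,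
        Complex.exp_two_pi_mul_I, mul_one]
    · rintro ⟨m, -, ⟨w, rfl⟩, hm, u, v, -, hv0, hcop, hvm, hmul⟩
      rw [Nat.mul_div_cancel_left w hm.1] at hvm
      subst hvm
      refine mem_curveBoundary_of_isPrimitiveRoot hd hv0 hm ?_
      rw [hmul]
      exact Complex.isPrimitiveRoot_exp_of_coprime u v (by omega) hcop
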